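/- **Model.** Consider agents $\mathcal N_a=\{1,\dots,N_a\}$ with unknown positions $\mathbf p_k\in\mathbb R^2$, $\mathbf P=(\mathbf p_1,\dots,\mathbf p_{N_a})$, and anchors $\mathcal N_b=\{N_a+1,\dots,N_a+N_b\}$ with known positions. Agent $k$ receives from some of the nodes $j\in(\mathcal N_a\cup\mathcal N_b)\setminus\{k\}$ the waveform $$r_{kj}(t)=\sum_{l=1}^{L_{kj}}\alpha_{kj}^{(l)}\,s\bigl(t-\tau_{kj}^{(l)}\bigr)+z_{kj}(t),\quad t\in[0,T_{\rm ob}),\qquad \tau_{kj}^{(l)}=\tfrac1c\bigl(d_{kj}+b_{kj}^{(l)}\bigr),\quad d_{kj}=\|\mathbf p_k-\mathbf p_j\|,$$ with $s$ a known waveform of finite energy, $c>0$, and independent white Gaussian noises $z_{kj}$ of two-sided power spectral density $N_0/2>0$. The waveform is represented by the vector $\mathbf r_{kj}$ of its coefficients in an orthonormal basis of $L^2[0,T_{\rm ob})$ (Karhunen–Loève expansion). The vector $\boldsymbol\kappa_{kj}$ consists of the biases $b_{kj}^{(l)}$ and amplitudes $\alpha_{kj}^{(l)}$; for a line-of-sight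 signal $b_{kj}^{(1)}=0$ is known and left out. The likelihood is $$f(\mathbf r_{kj}\mid d_{kj},\boldsymbol\kappa_{kj})\propto\exp\Bigl\{\tfrac{2}{N_0}\int_0^{T_{\rm ob}} r_{kj}(t)\,m_{kj}(t)\,dt-\tfrac1{N_0}\int_0^{T_{\rm ob}} m_{kj}(t)^2dt\Bigr\},\qquad m_{kj}(t)=\sum_l\alpha_{kj}^{(l)}s(t-\tau_{kj}^{(l)}).$$ The positions have a known a priori density $f(\mathbf P)$ and, given $\mathbf P$, the $\boldsymbol\kappa_{kj}$ are independent with densities $f(\boldsymbol\kappa_{kj}\mid d_{kj})$. Thus, with $\boldsymbol\theta=(\mathbf P,(\boldsymbol\kappa_{kj}))$ and the products over the received waveforms, $$f(\mathbf r,\boldsymbol\theta)=f(\mathbf P)\prod f(\boldsymbol\kappa_{kj}\mid d_{kj})\prod f(\mathbf r_{kj}\mid d_{kj},\boldsymbol\kappa_{kj}).$$ The Fisher information matrix is $\mathbf J_{\boldsymbol\theta}=\mathbb E_{\mathbf r,\boldsymbol\theta}\{-\partial^2\ln f(\mathbf r,\boldsymbol\theta)/\partial\boldsymbol\theta\,\partial\boldsymbol\theta^{\rm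 T}\}=\begin{bmatrix}\mathbf A&\mathbf B\\ \mathbf B^{\rm T}&\mathbf C\end{bmatrix}$, where $\mathbf A$ is the block of $\mathbf P$ and $\mathbf C$, assumed invertible, is the block of all the $\boldsymbol\kappa_{kj}$; the equivalent Fisher information matrix (EFIM) of $\mathbf P$ is $\mathbf J_e(\mathbf P)=\mathbf A-\mathbf B\mathbf C^{-1}\mathbf B^{\rm T}$. We assume the usual regularity: at almost every point (under the joint law) the three kinds of factors of $f(\mathbf r,\boldsymbol\theta)$ are twice continuously differentiable, as functions of $\mathbf P$ or of $(d_{kj},\boldsymbol\kappa_{kj})$, and the series expressing $\int r_{kj}m_{kj}$ in coefficients converges for all parameter values near the true one; the second partial derivatives with respect to $\boldsymbol\theta$ of $\ln f(\mathbf P)$ and of each $\ln f(\mathbf r_{kj}\mid d_{kj},\boldsymbol\kappa_{kj})+\ln f(\boldsymbol\kappa_{kj}\mid d_{kj})$ are integrable; and near every $d_0>0$, for almost every $\boldsymbol\kappa$, $f(\boldsymbol\kappa_{kj}\mid d)$ is differentiable in $d$, with derivative dominated by an integrable function of $\boldsymbol\kappa_{kj}$. **Theorem.** For each received waveform put $\mathbf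 q_{kj}=(\mathbf p_k-\mathbf p_j)/d_{kj}$ and, for $\mathbf x,\mathbf y\in\{d_{kj},\boldsymbol\kappa_{kj}\}$, $$\boldsymbol\Phi_{kj}(\mathbf x,\mathbf y)=\mathbb E\Bigl\{-\tfrac{\partial^2}{\partial\mathbf x\,\partial\mathbf y^{\rm T}}\bigl[\ln f(\mathbf r_{kj}\mid d_{kj},\boldsymbol\kappa_{kj})+\ln f(\boldsymbol\kappa_{kj}\mid d_{kj})\bigr]\Bigm|\mathbf P\Bigr\},$$ the expectation being over $\mathbf r_{kj},\boldsymbol\kappa_{kj}$ given $\mathbf P$. Then every $\mathbb E_{\mathbf P}\{\boldsymbol\Phi_{kj}(\boldsymbol\kappa_{kj},\boldsymbol\kappa_{kj})\}$ is invertible. Put $$\mathbf R(\mathbf r_{kj})=\mathbb E_{\mathbf P}\{\Phi_{kj}(d_{kj},d_{kj})\mathbf q_{kj}\mathbf q_{kj}^{\rm T}\}-\mathbb E_{\mathbf P}\{\mathbf q_{kj}\boldsymbol\Phi_{kj}(d_{kj},\boldsymbol\kappa_{kj})\}\,\mathbb E_{\mathbf P}\{\boldsymbol\Phi_{kj}(\boldsymbol\kappa_{kj},\boldsymbol\kappa_{kj})\}^{-1}\,\mathbb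 E_{\mathbf P}\{\boldsymbol\Phi_{kj}(\boldsymbol\kappa_{kj},d_{kj})\mathbf q_{kj}^{\rm T}\}\in\mathbb R^{2\times2},$$ and $\mathbf R(\mathbf r_{kj})=\mathbf 0$ if agent $k$ does not receive from node $j$. The $2N_a\times2N_a$ EFIM for the agents' positions is $$\mathbf J_e(\mathbf P)=\mathbf J_A(\mathbf P)+\mathbf J_C(\mathbf P)+\boldsymbol\Xi_{\mathbf P},\qquad \boldsymbol\Xi_{\mathbf P}=\mathbb E_{\mathbf P}\Bigl\{-\frac{\partial^2\ln f(\mathbf P)}{\partial\mathbf P\,\partial\mathbf P^{\rm T}}\Bigr\},$$ where the $2\times2$ blocks $(k,m)$, $k,m\in\mathcal N_a$, of $\mathbf J_A(\mathbf P)$ and $\mathbf J_C(\mathbf P)$ are $$[\mathbf J_A]_{k,k}=\sum_{j\in\mathcal N_b}\mathbf R(\mathbf r_{kj}),\quad [\mathbf J_C]_{k,k}=\sum_{j\in\mathcal N_a\setminus\{k\}}[\mathbf R(\mathbf r_{kj})+\mathbf R(\mathbf r_{jk})],$$ and, for $k\ne m$, $[\mathbf J_A]_{k,m}=\mathbf 0$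 and $[\mathbf J_C]_{k,m}=-[\mathbf R(\mathbf r_{km})+\mathbf R(\mathbf r_{mk})]$. -/

import Mathlib

open MeasureTheory ProbabilityTheory Filter Topology
open scoped ENNReal NNReal Matrix

noncomputable section

namespace CoopLoc

/-- The plane with its Euclidean norm. -/
abbrev Plane : Type := EuclideanSpace ℝ (Fin 2)

/-- Nodes of the network: agents (left) and anchors (right). -/
abbrev Node (Na Nb : ℕ) : Type := Fin Na ⊕ Fin Nb

/-- The known data of a wideband network with `Na` agents and `Nb` anchors.
`comm k j` says that agent `k` receives the waveform sent by node `j`; `L k j` is the number of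
multipath components of that waveform; `los k j` says that it is a line-of-sight signal, so that
the range bias of its first path is known to be zero.  The transmitted waveform is `s`, the
propagation speed `c`, the noise has two-sided power spectral density `N0 / 2`, and waveforms are
observed on `[0, Tob)`.  `kl` is the orthonormal basis of `L²[0, Tob)` used in the
Karhunen-Loève expansion. -/
structure Network (Na Nb : ℕ) where
  anchor : Fin Nb → Plane
  comm : Fin Na → Node Na Nb → Bool
  L : Fin Na → Node Na Nb → ℕ
  los : Fin Na → Node Na Nb → Bool
  s : ℝ → ℝ
  s_memLp : MemLp s 2 volume
  c : ℝ
  c_pos : 0 < c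
  N0 : ℝ
  N0_pos : 0 < N0
  Tob : ℝ
  Tob_pos : 0 < Tob
  kl : HilbertBasis ℕ ℝ (Lp ℝ 2 (volume.restrict (Set.Ico 0 Tob)))

variable {Na Nb : ℕ}

namespace Network

variable (N : Network Na Nb)

/-- The received waveforms `r_{kj}`: pairs of an agent `k` and a node `j ≠ k` that it hears. -/
abbrev Link : Type :=
  {e : Fin Na × Node Na Nb // e.2 ≠ Sum.inl e.1 ∧ N.comm e.1 e.2 = true}

/-- The receiving agent of a waveform. -/
abbrev rx (e : N.Link) : Fin Na := e.1.1

/-- The transmitting node of a waveform. -/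
abbrev tx (e : N.Link) : Node Na Nb := e.1.2

/-- The number of paths of a waveform. -/
abbrev paths (e : N.Link) : ℕ := N.L e.1.1 e.1.2

/-- Indices of the unknown range biases of a waveform: all paths, except the first path of a
line-of-sight signal. -/
abbrev BiasIdx (e : N.Link) : Type :=
  {l : Fin (N.paths e) // ¬ (N.los e.1.1 e.1.2 = true ∧ l.val = 0)}

/-- Coordinates of the multipath parameter vector `κ_{kj}`: the unknown range biases and the
amplitudes. -/
abbrev Coord (e : N.Link) : Type := N.BiasIdx e ⊕ Fin (N.paths e)

/-- Values of the multipath parameter vector `κ_{kj}`. -/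
abbrev Chan (e : N.Link) : Type := N.Coord e → ℝ

/-- Positions of all agents, the vector `P`. -/
abbrev Pos (_ : Network Na Nb) : Type := Fin Na → Plane

/-- All channel parameters. -/
abbrev Chans : Type := ∀ e : N.Link, N.Chan e

/-- The parameter vector `θ = (P, κ)`. -/
abbrev Param : Type := N.Pos × N.Chans

/-- Karhunen-Loève coefficients of all received waveforms, the observation `r`. -/
abbrev Obs : Type := N.Link → ℕ → ℝ

/-- Position of a node. -/
def nodePos (P : N.Pos) : Node Na Nb → Plane
  | Sum.inl k => P k
  | Sum.inr j => N.anchor j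

/-- The distance `d_{kj} = ‖p_k - p_j‖`. -/
def dist (e : N.Link) (P : N.Pos) : ℝ := ‖N.nodePos P (Sum.inl (N.rx e)) - N.nodePos P (N.tx e)‖

/-- The unit vector `q_{kj} = (p_k - p_j) / ‖p_k - p_j‖ = (cos φ_{kj}, sin φ_{kj})`. -/
def q (e : N.Link) (P : N.Pos) : Plane :=
  (N.dist e P)⁻¹ • (N.nodePos P (Sum.inl (N.rx e)) - N.nodePos P (N.tx e))

/-! ### Signal model -/

/-- Range bias of the `l`-th path. -/
def bias (e : N.Link) (κ : N.Chan e) (l : Fin (N.paths e)) : ℝ :=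
  if h : ¬ (N.los e.1.1 e.1.2 = true ∧ l.val = 0) then κ (Sum.inl ⟨l, h⟩) else 0

/-- Amplitude of the `l`-th path. -/
def amp (e : N.Link) (κ : N.Chan e) (l : Fin (N.paths e)) : ℝ := κ (Sum.inr l)

/-- Delay of the `l`-th path. -/
def delay (e : N.Link) (d : ℝ) (κ : N.Chan e) (l : Fin (N.paths e)) : ℝ :=
  (d + N.bias e κ l) / N.c

/-- The noise-free received waveform at distance `d`. -/
def signal (e : N.Link) (d : ℝ) (κ : N.Chan e) (t : ℝ) : ℝ :=
  ∑ l : Fin (N.paths e), N.amp e κ l * N.s (t - N.delay e d κ l)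

/-- Karhunen-Loève coefficients of the noise-free received waveform. -/
def coef (e : N.Link) (d : ℝ) (κ : N.Chan e) (n : ℕ) : ℝ :=
  ∫ t in Set.Ico 0 N.Tob, N.signal e d κ t * N.kl n t

/-- Law of the coefficients of white Gaussian noise in one waveform: independent centred Gaussians
of variance `N0 / 2`. -/
def noise₁ (N : Network Na Nb) : Measure (ℕ → ℝ) :=
  Measure.infinitePi fun _ : ℕ => gaussianReal 0 (N.N0 / 2).toNNReal

/-- Law of the noise in all waveforms (independent between waveforms). -/
def noise : Measure N.Obs := Measure.pi fun _ : N.Link => N.noise₁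

/-- Observation of one waveform: signal plus noise. -/
def recv₁ (e : N.Link) (d : ℝ) (κ : N.Chan e) (z : ℕ → ℝ) : ℕ → ℝ :=
  fun n => N.coef e d κ n + z n

/-- Observation of all waveforms: signal plus noise. -/
def recv (θ : N.Param) (z : N.Obs) : N.Obs :=
  fun e => N.recv₁ e (N.dist e θ.1) (θ.2 e) (z e)

/-- Partial sums of `∑ₙ rₙ mₙ`, where `m` is the noise-free waveform. -/
def corrPartial (e : N.Link) (r : ℕ → ℝ) (x : ℝ × N.Chan e) (M : ℕ) : ℝ :=
  ∑ n ∈ Finset.range M, r n * N.coef e x.1 x.2 n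

/-- The correlation `∫₀^Tob r(t) m(t) dt` of the observation with the noise-free waveform `m`,
expressed in the Karhunen-Loève coefficients. -/
def corr (e : N.Link) (r : ℕ → ℝ) (x : ℝ × N.Chan e) : ℝ :=
  limUnder atTop (N.corrPartial e r x)

/-- The likelihood `f(r_{kj} | d_{kj}, κ_{kj})` (density with respect to the law of the noise). -/
def lik (e : N.Link) (r : ℕ → ℝ) (x : ℝ × N.Chan e) : ℝ :=
  Real.exp (2 / N.N0 * N.corr e r x
    - 1 / N.N0 * ∫ t in Set.Ico 0 N.Tob, (N.signal e x.1 x.2 t) ^ 2)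

end Network

/-! ### Prior knowledge -/

/-- A priori distribution of the parameters: the joint density `pos` of the agents' positions and,
for each waveform, the conditional density `chan e d` of its multipath parameters given that the
distance between its two nodes is `d > 0`. -/
structure Prior (N : Network Na Nb) where
  pos : N.Pos → ℝ
  pos_meas : Measurable pos
  pos_nonneg : ∀ P, 0 ≤ pos P
  pos_lintegral : ∫⁻ P, ENNReal.ofReal (pos P) = 1
  chan : ∀ e : N.Link, ℝ → N.Chan e → ℝ
  chan_meas : ∀ e, Measurable (Function.uncurry (chan e))
  chan_nonneg : ∀ e d κ, 0 ≤ chan e d κ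
  chan_lintegral : ∀ e d, 0 < d → ∫⁻ κ, ENNReal.ofReal (chan e d κ) = 1

namespace Prior

variable {N : Network Na Nb} (f : Prior N)

/-- The a priori density `f(θ) = f(P) ∏ f(κ_{kj} | d_{kj})`: channel parameters of different
waveforms are independent given the positions. -/
def paramPDF (θ : N.Param) : ℝ := f.pos θ.1 * ∏ e : N.Link, f.chan e (N.dist e θ.1) (θ.2 e)

/-- The joint density `f(r, θ) = f(r | θ) f(θ)`. -/
def jointPDF (r : N.Obs) (θ : N.Param) : ℝ :=
  (∏ e : N.Link, N.lik e (r e) (N.dist e θ.1, θ.2 e)) * f.paramPDF θ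

/-- Law of the positions. -/
def posLaw : Measure N.Pos := volume.withDensity fun P => ENNReal.ofReal (f.pos P)

/-- Law of the parameters. -/
def paramLaw : Measure N.Param := volume.withDensity fun θ => ENNReal.ofReal (f.paramPDF θ)

/-- Joint law of the parameters and the noise (independent).  The observation is `N.recv θ z`. -/
def law : Measure (N.Param × N.Obs) := f.paramLaw.prod N.noise

/-- Law of the multipath parameters and the noise of one waveform, given the distance. -/
def linkLaw (e : N.Link) (d : ℝ) : Measure (N.Chan e × (ℕ → ℝ)) :=
  (volume.withDensity fun κ => ENNReal.ofReal (f.chan e d κ)).prod N.noise₁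

end Prior

/-! ### Fisher information -/

/-- The second partial derivative `∂²F / ∂u ∂v` at `x`, for directions `u` and `v`. -/
def partial₂ {E : Type*} [AddCommGroup E] [Module ℝ E] (F : E → ℝ) (u v x : E) : ℝ :=
  lineDeriv ℝ (fun y => lineDeriv ℝ F y v) x u

/-- The equivalent Fisher information matrix for the first block of parameters,
`A - B C⁻¹ Bᵀ` for the Fisher information matrix `[A B; Bᵀ C]`. -/
def equivFisher {m n : Type*} [Fintype n] [DecidableEq n] (J : Matrix (m ⊕ n) (m ⊕ n) ℝ) :
    Matrix m m ℝ :=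
  J.toBlocks₁₁ - J.toBlocks₁₂ * (J.toBlocks₂₂)⁻¹ * (J.toBlocks₁₂)ᵀ

namespace Network

variable (N : Network Na Nb)

/-- Coordinates of `P`; the pair `(k, a)` is the `a`-th coordinate of the position of agent `k`. -/
abbrev PosIdx (_ : Network Na Nb) : Type := Fin Na × Fin 2

/-- Coordinates of all channel parameters. -/
abbrev ChanIdx : Type := Σ e : N.Link, N.Coord e

/-- Coordinate direction of `P`. -/
def posDir (i : N.PosIdx) : N.Pos := Pi.single i.1 (EuclideanSpace.single i.2 1)

/-- Coordinate direction of `θ`. -/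
def paramDir : N.PosIdx ⊕ N.ChanIdx → N.Param
  | Sum.inl i => (N.posDir i, 0)
  | Sum.inr i => (0, Pi.single i.1 (Pi.single i.2 1))

/-- Coordinate direction of `(d_{kj}, κ_{kj})`; the left index is `d_{kj}`. -/
def linkDir (e : N.Link) : Unit ⊕ N.Coord e → ℝ × N.Chan e
  | Sum.inl _ => (1, 0)
  | Sum.inr i => (0, Pi.single i 1)

end Network

namespace Prior

variable {N : Network Na Nb} (f : Prior N)

/-- The Fisher information matrix of `θ`, `E {- ∂² ln f(r, θ) / ∂θ ∂θᵀ}`. -/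
def fisher : Matrix (N.PosIdx ⊕ N.ChanIdx) (N.PosIdx ⊕ N.ChanIdx) ℝ :=
  Matrix.of fun i j => ∫ ω, - partial₂ (fun θ => Real.log (f.jointPDF (N.recv ω.1 ω.2) θ))
    (N.paramDir i) (N.paramDir j) ω.1 ∂f.law

/-- The contribution `ln f(r_{kj} | d_{kj}, κ_{kj}) + ln f(κ_{kj} | d_{kj})` of one waveform to the
logarithm of the joint density, as a function of `(d_{kj}, κ_{kj})`. -/
def linkLog (e : N.Link) (r : ℕ → ℝ) (x : ℝ × N.Chan e) : ℝ :=
  Real.log (N.lik e r x) + Real.log (f.chan e x.1 x.2)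

/-- `Φ_{kj}(x, y)` for coordinates `x`, `y` of `(d_{kj}, κ_{kj})`, when the distance is `d`. -/
def Phi (e : N.Link) (i j : Unit ⊕ N.Coord e) (d : ℝ) : ℝ :=
  ∫ w, - partial₂ (f.linkLog e (N.recv₁ e d w.1 w.2)) (N.linkDir e i) (N.linkDir e j) (d, w.1)
    ∂f.linkLaw e d

/-- `E_P {Φ_{kj}(d, d) q qᵀ}`. -/
def meanDD (e : N.Link) : Matrix (Fin 2) (Fin 2) ℝ :=
  Matrix.of fun a b =>
    ∫ P, f.Phi e (Sum.inl ()) (Sum.inl ()) (N.dist e P) * (N.q e P a * N.q e P b) ∂f.posLaw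

/-- `E_P {q Φ_{kj}(d, κ)}`. -/
def meanDK (e : N.Link) : Matrix (Fin 2) (N.Coord e) ℝ :=
  Matrix.of fun a i => ∫ P, N.q e P a * f.Phi e (Sum.inl ()) (Sum.inr i) (N.dist e P) ∂f.posLaw

/-- `E_P {Φ_{kj}(κ, d) qᵀ}`. -/
def meanKD (e : N.Link) : Matrix (N.Coord e) (Fin 2) ℝ :=
  Matrix.of fun i b => ∫ P, f.Phi e (Sum.inr i) (Sum.inl ()) (N.dist e P) * N.q e P b ∂f.posLaw

/-- `E_P {Φ_{kj}(κ, κ)}`. -/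
def meanKK (e : N.Link) : Matrix (N.Coord e) (N.Coord e) ℝ :=
  Matrix.of fun i j => ∫ P, f.Phi e (Sum.inr i) (Sum.inr j) (N.dist e P) ∂f.posLaw

/-- The ranging information of a received waveform. -/
def linkRI (e : N.Link) : Matrix (Fin 2) (Fin 2) ℝ :=
  f.meanDD e - f.meanDK e * (f.meanKK e)⁻¹ * f.meanKD e

/-- The ranging information `R(r_{kj})`; zero if `r_{kj}` is not observed. -/
def RI (k : Fin Na) (j : Node Na Nb) : Matrix (Fin 2) (Fin 2) ℝ :=
  if h : j ≠ Sum.inl k ∧ N.comm k j = true then f.linkRI ⟨(k, j), h⟩ else 0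

/-- Localization information from anchors. -/
def JA : Matrix N.PosIdx N.PosIdx ℝ :=
  Matrix.of fun x y =>
    if x.1 = y.1 then (∑ j : Fin Nb, f.RI x.1 (Sum.inr j)) x.2 y.2 else 0

/-- Localization information from the cooperation of agents. -/
def JC : Matrix N.PosIdx N.PosIdx ℝ :=
  Matrix.of fun x y =>
    if x.1 = y.1 then
      (∑ j ∈ Finset.univ.erase x.1, (f.RI x.1 (Sum.inl j) + f.RI j (Sum.inl x.1))) x.2 y.2
    else (-(f.RI x.1 (Sum.inl y.1) + f.RI y.1 (Sum.inl x.1))) x.2 y.2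

/-- Fisher information of the a priori distribution of the positions,
`Ξ_P = E_P {- ∂² ln f(P) / ∂P ∂Pᵀ}`. -/
def Xi : Matrix N.PosIdx N.PosIdx ℝ :=
  Matrix.of fun i j =>
    ∫ P, - partial₂ (fun P' => Real.log (f.pos P')) (N.posDir i) (N.posDir j) P ∂f.posLaw

/-- Regularity conditions under which the Fisher information of the model is defined: the three
kinds of factors of the joint density are twice continuously differentiable in the parameters at
almost every point, their logarithms have integrable second partial derivatives, and the conditional
densities of the channel parameters may be differentiated once in the distance under the
integral sign (their derivatives are locally dominated). -/
structure Regular : Prop where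
  /-- The position density is twice continuously differentiable almost surely. -/
  pos_contDiffAt : ∀ᵐ P ∂f.posLaw, ContDiffAt ℝ 2 f.pos P
  /-- The prior information of the positions exists. -/
  pos_integrable : ∀ i j : N.PosIdx, Integrable
    (partial₂ (fun P' => Real.log (f.pos P')) (N.posDir i) (N.posDir j)) f.posLaw
  /-- The channel densities are twice continuously differentiable almost surely. -/
  chan_contDiffAt : ∀ e : N.Link, ∀ᵐ θ ∂f.paramLaw,
    ContDiffAt ℝ 2 (Function.uncurry (f.chan e)) (N.dist e θ.1, θ.2 e)
  /-- Locally uniform domination of the distance derivative of the channel densities. -/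
  chan_dominated : ∀ (e : N.Link) (d₀ : ℝ), 0 < d₀ →
    ∃ ε > 0, ∃ g : N.Chan e → ℝ, Integrable g ∧ ∀ᵐ κ, ∀ d ∈ Metric.ball d₀ ε,
      DifferentiableAt ℝ (fun d' => f.chan e d' κ) d ∧ |deriv (fun d' => f.chan e d' κ) d| ≤ g κ
  /-- Almost surely, the series of the correlation integral converges near the true parameters. -/
  lik_convergent : ∀ e : N.Link, ∀ᵐ ω ∂f.law,
    ∀ᶠ x in 𝓝 (N.dist e ω.1.1, ω.1.2 e),
      ∃ l : ℝ, Tendsto (N.corrPartial e (N.recv ω.1 ω.2 e) x) atTop (𝓝 l)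
  /-- Almost surely, the likelihood is twice continuously differentiable at the true parameters. -/
  lik_contDiffAt : ∀ e : N.Link, ∀ᵐ ω ∂f.law,
    ContDiffAt ℝ 2 (N.lik e (N.recv ω.1 ω.2 e)) (N.dist e ω.1.1, ω.1.2 e)
  /-- The information carried by each waveform exists. -/
  link_integrable : ∀ (e : N.Link) (i j : N.PosIdx ⊕ N.ChanIdx), Integrable
    (fun ω : N.Param × N.Obs => partial₂
      (fun θ => f.linkLog e (N.recv ω.1 ω.2 e) (N.dist e θ.1, θ.2 e))
      (N.paramDir i) (N.paramDir j) ω.1) f.law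

end Prior

end CoopLoc

end

/-! The logarithm of the joint density is `ln f(P)` plus one term per waveform, and the term of a
waveform sees the positions only through its distance. Differentiating such a term twice in the
positions gives its second derivative in `d` times a product of two components of the gradient of
the distance, plus the Hessian of the distance times the first derivative in `d` (the range score).
That gradient is `q` at the receiver, `-q` at a transmitting agent and zero at all other agents;
`sgn` records the sign.

The score term must average to zero given `P` (`Regular.integral_lineDeriv_linkLog`). For the
likelihood this is a symmetry argument: the log-likelihoods under noise `z` and `-z` add up to a
constant minus a multiple of the squared `L²` distance between the true and the trial signal. The
sum is largest at the true parameters, so the two scores cancel (`lineDeriv_log_lik_neg`), while the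
noise law is invariant under `z ↦ -z`. The transmitted waveform itself is never differentiated. For
the channel density one differentiates `∫ f(κ | d) dκ = 1` under the integral sign
(`Regular.integral_deriv_chan`).

Given `P` the waveforms are independent, so the conditional mean of a quantity of one waveform is an
integral over `linkLaw` (`link_fibre`), which is how `Phi` appears. The channel block `C` is then
block diagonal with blocks `meanKK e`, and the Schur complement splits into one summand `sgn · sgn ·
linkRI` per waveform (`Regular.equivFisher_apply`). Summing these rank-one sign patterns over the
network gives a weighted graph Laplacian: pairs of agents produce `JC`, and links to anchors, which
have only one free end, produce `JA` (`sum_sgn_linkRI`). -/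

noncomputable section

namespace CoopLoc

/-! ### Product measures -/

/-- A product of densities is the density of the product measure. -/
theorem pi_withDensity_ofReal {ι : Type*} [Fintype ι] {E : ι → Type*}
    [∀ i, MeasureSpace (E i)] [∀ i, SigmaFinite (volume : Measure (E i))] (g : ∀ i, E i → ℝ)
    (hnn : ∀ i x, 0 ≤ g i x) (hg : ∀ i, Integrable (g i)) :
    Measure.pi (fun i => (volume : Measure (E i)).withDensity fun x => ENNReal.ofReal (g i x)) =
      (volume : Measure (∀ i, E i)).withDensity fun x => ∏ i, ENNReal.ofReal (g i (x i)) := by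
  have hfin : ∀ i, IsFiniteMeasure
      ((volume : Measure (E i)).withDensity fun x => ENNReal.ofReal (g i x)) :=
    fun i => isFiniteMeasure_withDensity_ofReal (hg i).2
  refine Measure.pi_eq fun s hs => ?_
  have hbox : MeasurableSet (Set.univ.pi s) := MeasurableSet.univ_pi hs
  have hint : ∀ i, Integrable ((s i).indicator (g i)) := fun i => (hg i).indicator (hs i)
  rw [withDensity_apply _ hbox, ← lintegral_indicator hbox]
  have h1 : (fun x : ∀ i, E i => (Set.univ.pi s).indicator
      (fun x => ∏ i, ENNReal.ofReal (g i (x i))) x) =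
      fun x => ENNReal.ofReal (∏ i, (s i).indicator (g i) (x i)) := by
    funext x
    by_cases hx : x ∈ Set.univ.pi s
    · rw [Set.indicator_of_mem hx, ENNReal.ofReal_prod_of_nonneg
        fun i _ => Set.indicator_nonneg (fun y _ => hnn i y) _]
      exact Finset.prod_congr rfl fun i _ => by rw [Set.indicator_of_mem (hx i trivial)]
    · rw [Set.indicator_of_notMem hx]
      obtain ⟨i, hi⟩ : ∃ i, x i ∉ s i := by simpa [Set.mem_pi] using hx
      rw [Finset.prod_eq_zero (Finset.mem_univ i) (Set.indicator_of_notMem hi _),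
        ENNReal.ofReal_zero]
  rw [h1, volume_pi, ← ofReal_integral_eq_lintegral_ofReal
      (f := fun x : ∀ i, E i => ∏ i, (s i).indicator (g i) (x i))
    (Integrable.fintype_prod_dep hint) (ae_of_all _ fun x => Finset.prod_nonneg fun i _ =>
      Set.indicator_nonneg (fun y _ => hnn i y) _),
    integral_fintype_prod_eq_prod, ENNReal.ofReal_prod_of_nonneg
      fun i _ => integral_nonneg (Set.indicator_nonneg fun y _ => hnn i y)]
  refine Finset.prod_congr rfl fun i _ => ?_
  rw [withDensity_apply _ (hs i), ← lintegral_indicator (hs i),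
    ofReal_integral_eq_lintegral_ofReal (hint i)
      (ae_of_all _ (Set.indicator_nonneg fun y _ => hnn i y))]
  refine lintegral_congr fun x => ?_
  by_cases hx : x ∈ s i <;> simp [hx]

/-- Resampling one coordinate preserves a product of probability measures. -/
theorem measurePreserving_update {ι : Type*} [Fintype ι] [DecidableEq ι] {E : ι → Type*}
    [∀ i, MeasurableSpace (E i)] (μ : ∀ i, Measure (E i)) [∀ i, IsProbabilityMeasure (μ i)]
    (e : ι) :
    MeasurePreserving (fun w : E e × (∀ i, E i) => Function.update w.2 e w.1)
      ((μ e).prod (Measure.pi μ)) (Measure.pi μ) := by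
  have hm : Measurable fun w : E e × (∀ i, E i) => Function.update w.2 e w.1 := by
    refine measurable_pi_lambda _ fun i => ?_
    by_cases h : i = e
    · subst h; simpa using measurable_fst
    · simpa [Function.update_of_ne h, Function.comp_def] using
        (measurable_pi_apply (X := E) i).comp (measurable_snd (α := E e))
  refine ⟨hm, (Measure.pi_eq fun s hs => ?_).symm⟩
  rw [Measure.map_apply hm (MeasurableSet.univ_pi hs)]
  -- The old `e`-th coordinate is overwritten, so it is unconstrained and contributes total mass 1.
  have : (fun w : E e × (∀ i, E i) => Function.update w.2 e w.1) ⁻¹' (Set.univ.pi s) =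
      s e ×ˢ (Set.univ.pi (Function.update s e Set.univ)) := by
    ext w
    simp only [Set.mem_preimage, Set.mem_pi, Set.mem_univ, true_imp_iff, Set.mem_prod]
    constructor
    · intro h
      refine ⟨by simpa using h e, fun i => ?_⟩
      by_cases hi : i = e
      · subst hi; simp
      · simpa [Function.update_of_ne hi] using h i
    · rintro ⟨h1, h2⟩ i
      by_cases hi : i = e
      · subst hi; simpa using h1
      · simpa [Function.update_of_ne hi] using h2 i
  rw [this, Measure.prod_prod, Measure.pi_pi, ← Finset.mul_prod_erase _ _ (Finset.mem_univ e),
    ← Finset.mul_prod_erase Finset.univ (fun i => μ i (s i)) (Finset.mem_univ e)]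
  simp only [Function.update_self, measure_univ, one_mul]
  congr 1
  refine Finset.prod_congr rfl fun i hi => ?_
  rw [Function.update_of_ne (Finset.ne_of_mem_erase hi)]

/-- Regroups the factors so that channel parameters and noise can be resampled independently in
`measurePreserving_resample`. -/
theorem measurePreserving_prodProdComm {α β γ δ : Type*} [MeasurableSpace α] [MeasurableSpace β]
    [MeasurableSpace γ] [MeasurableSpace δ] (a : Measure α) (b : Measure β) (c : Measure γ)
    (d : Measure δ) [IsProbabilityMeasure a] [IsProbabilityMeasure b] [IsProbabilityMeasure c]
    [IsProbabilityMeasure d] :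
    MeasurePreserving (fun x : (α × β) × (γ × δ) => ((x.1.1, x.2.1), (x.1.2, x.2.2)))
      ((a.prod b).prod (c.prod d)) ((a.prod c).prod (b.prod d)) := by
  have hm : Measurable fun x : (α × β) × (γ × δ) => ((x.1.1, x.2.1), (x.1.2, x.2.2)) := by
    fun_prop
  refine ⟨hm, ?_⟩
  refine Measure.ext_of_lintegral _ fun g hg => ?_
  rw [lintegral_map hg hm, lintegral_prod _ (by fun_prop), lintegral_prod _ (by fun_prop),
    lintegral_prod _ (by fun_prop), lintegral_prod _ (by fun_prop)]
  refine lintegral_congr fun x => ?_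
  simp_rw [fun y => lintegral_prod (μ := c) (ν := d) (fun z : γ × δ => g ((x, z.1), (y, z.2)))
    (by fun_prop)]
  rw [lintegral_lintegral_swap (by fun_prop)]
  refine lintegral_congr fun y => ?_
  rw [lintegral_prod _ (by fun_prop)]

theorem withDensity_compProd_withDensity {X Y : Type*} [MeasurableSpace X] [MeasurableSpace Y]
    (μ : Measure X) (ν : Measure Y) [SFinite μ] [SFinite ν] {a : X → ℝ≥0∞} {b : X → Y → ℝ≥0∞}
    (ha : Measurable a) (hb : Measurable (Function.uncurry b)) (hb' : ∀ x y, b x y ≠ ∞) :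
    μ.withDensity a ⊗ₘ Kernel.withDensity (Kernel.const X ν) b =
      (μ.prod ν).withDensity fun z => a z.1 * b z.1 z.2 := by
  have := Kernel.IsSFiniteKernel.withDensity (Kernel.const X ν) hb'
  have hab : Measurable fun z : X × Y => a z.1 * b z.1 z.2 := (ha.comp measurable_fst).mul hb
  refine Measure.ext_of_lintegral _ fun g hg => ?_
  rw [Measure.lintegral_compProd hg, lintegral_withDensity_eq_lintegral_mul _ ha
      (Measurable.lintegral_kernel_prod_right' hg),
    lintegral_withDensity_eq_lintegral_mul _ hab hg, lintegral_prod _ (hab.mul hg).aemeasurable]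
  refine lintegral_congr fun x => ?_
  have hbx : Measurable (b x) := hb.comp measurable_prodMk_left
  simp only [Pi.mul_apply]
  rw [Kernel.lintegral_withDensity _ hb _ (by fun_prop), Kernel.const_apply,
    ← lintegral_const_mul _ (by fun_prop)]
  simp_rw [mul_assoc]

/-- If `H` pulls back to a function `G` of the first factor under a measure-preserving map from a
product, then `G` is integrable with the same integral. No measurability of `G` is assumed. -/
theorem integral_of_section {X Y Z : Type*} [MeasurableSpace X] [MeasurableSpace Y]
    [MeasurableSpace Z] {μ : Measure X} {ν : Measure Y} {ρ : Measure Z} [SFinite ν]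
    [IsProbabilityMeasure ρ] {ψ : Y × Z → X} (hψ : MeasurePreserving ψ (ν.prod ρ) μ)
    {H : X → ℝ} {G : Y → ℝ} (hHG : ∀ y z, H (ψ (y, z)) = G y) (hH : Integrable H μ) :
    Integrable G ν ∧ ∫ x, H x ∂μ = ∫ y, G y ∂ν := by
  have h1 : Integrable (fun w : Y × Z => G w.1) (ν.prod ρ) := by
    have := hψ.integrable_comp_of_integrable hH
    exact this.congr (ae_of_all _ fun w => hHG w.1 w.2)
  refine ⟨h1.of_comp_fst (IsProbabilityMeasure.ne_zero ρ), ?_⟩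
  calc ∫ x, H x ∂μ = ∫ x, H x ∂((ν.prod ρ).map ψ) := by rw [hψ.map_eq]
    _ = ∫ w, H (ψ w) ∂(ν.prod ρ) := by
        refine integral_map hψ.measurable.aemeasurable ?_
        rw [hψ.map_eq]; exact hH.aestronglyMeasurable
    _ = ∫ w, G w.1 ∂(ν.prod ρ) := by
        exact integral_congr_ae (ae_of_all _ fun w => hHG w.1 w.2)
    _ = ∫ y, G y ∂ν := by rw [integral_fun_fst]; simp

/-- By Fubini, over almost every `y` the property holds for almost all `z`, hence for some `z`
because `ρ` has mass 1, and one `z` is enough. Neither predicate has to be measurable. -/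
theorem ae_of_section {X Y Z : Type*} [MeasurableSpace X] [MeasurableSpace Y]
    [MeasurableSpace Z] {μ : Measure X} {ν : Measure Y} {ρ : Measure Z} [SFinite ν]
    [IsProbabilityMeasure ρ] {ψ : Y × Z → X} (hψ : MeasurePreserving ψ (ν.prod ρ) μ)
    {p : X → Prop} {r : Y → Prop} (hpr : ∀ y z, p (ψ (y, z)) → r y) (hp : ∀ᵐ x ∂μ, p x) :
    ∀ᵐ y ∂ν, r y := by
  have h := Measure.ae_ae_of_ae_prod (hψ.quasiMeasurePreserving.ae hp)
  filter_upwards [h] with y hy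
  obtain ⟨z, hz⟩ := hy.exists
  exact hpr y z hz

/-! ### Laws of the model -/

variable {Na Nb : ℕ} (N : Network Na Nb)

namespace Network

@[fun_prop]
theorem continuous_nodePos (j : Node Na Nb) : Continuous fun P : N.Pos => N.nodePos P j := by
  cases j with
  | inl k => exact continuous_apply k
  | inr j => exact continuous_const

@[fun_prop]
theorem continuous_dist (e : N.Link) : Continuous (N.dist e) := by
  unfold Network.dist; fun_prop

theorem measurable_dist (e : N.Link) : Measurable (N.dist e) := (N.continuous_dist e).measurable

/-- Coincidence of the two nodes confines `P` to a proper linear subspace (two agents) or fixes one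
coordinate block (an anchor); both sets are null. Zero distance must be avoided because the norm is
not differentiable there and `chan e d` is normalized only for `d > 0`. -/
theorem nodePos_tx_ne (e : N.Link) : ∀ᵐ P : N.Pos, N.nodePos P (N.tx e) ≠ P (N.rx e) := by
  obtain ⟨⟨k, j⟩, hne, hc⟩ := e
  cases j with
  | inl m =>
    have hmk : m ≠ k := fun h => hne (by simp [h])
    let S : Submodule ℝ (Fin Na → Plane) :=
      LinearMap.ker ((LinearMap.proj m : (Fin Na → Plane) →ₗ[ℝ] Plane) - LinearMap.proj k)
    have hS : S ≠ ⊤ := by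
      intro h
      have : (Pi.single m (EuclideanSpace.single 0 1) : Fin Na → Plane) ∈ S := by
        rw [h]; trivial
      simp [S, LinearMap.mem_ker, hmk.symm] at this
    have h0 := Measure.addHaar_submodule (volume : Measure (Fin Na → Plane)) S hS
    have h1 : ∀ᵐ P : Fin Na → Plane, P ∉ S := compl_mem_ae_iff.2 h0
    filter_upwards [h1] with P hP h
    apply hP
    change P m = P k at h
    simp [S, LinearMap.mem_ker, h]
  | inr a =>
    have h0 := Measure.pi_hyperplane (fun _ : Fin Na => (volume : Measure Plane)) k (N.anchor a)
    have h1 : ∀ᵐ P : Fin Na → Plane, P ∉ {P : Fin Na → Plane | P k = N.anchor a} :=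
      compl_mem_ae_iff.2 h0
    filter_upwards [h1] with P hP h
    exact hP h.symm

theorem dist_pos_ae (e : N.Link) : ∀ᵐ P : N.Pos, 0 < N.dist e P := by
  filter_upwards [N.nodePos_tx_ne e] with P hP
  exact norm_pos_iff.2 (sub_ne_zero.2 fun h => hP h.symm)

instance : IsProbabilityMeasure N.noise₁ := by unfold noise₁; infer_instance

instance : IsProbabilityMeasure N.noise := by unfold noise; infer_instance

theorem measurePreserving_neg_noise₁ : MeasurePreserving (fun z : ℕ → ℝ => -z) N.noise₁ N.noise₁ := by
  refine ⟨measurable_neg, ?_⟩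
  have h := Measure.infinitePi_map_pi
    (μ := fun _ : ℕ => gaussianReal 0 (N.N0 / 2).toNNReal) (f := fun _ x => -x)
    (fun _ => measurable_neg)
  simp only [gaussianReal_map_neg, neg_zero] at h
  exact h

end Network

namespace Prior

variable {N} (f : Prior N)

instance : SFinite f.posLaw := by unfold posLaw; infer_instance

theorem posLaw_ac : f.posLaw ≪ volume := withDensity_absolutelyContinuous _ _

/-- Law of the multipath parameters of one waveform, given the distance. -/
def chanLaw (e : N.Link) (d : ℝ) : Measure (N.Chan e) :=
  volume.withDensity fun κ => ENNReal.ofReal (f.chan e d κ)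

theorem linkLaw_eq (e : N.Link) (d : ℝ) : f.linkLaw e d = (f.chanLaw e d).prod N.noise₁ := rfl

theorem measurable_chan (e : N.Link) (d : ℝ) : Measurable (f.chan e d) :=
  (f.chan_meas e).comp measurable_prodMk_left

theorem isProbabilityMeasure_chanLaw (e : N.Link) {d : ℝ} (hd : 0 < d) :
    IsProbabilityMeasure (f.chanLaw e d) :=
  ⟨by rw [chanLaw, withDensity_apply _ .univ, setLIntegral_univ, f.chan_lintegral e d hd]⟩

theorem integrable_chan (e : N.Link) {d : ℝ} (hd : 0 < d) : Integrable (f.chan e d) := by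
  refine ⟨(f.measurable_chan e d).aestronglyMeasurable, ?_⟩
  rw [hasFiniteIntegral_iff_ofReal (ae_of_all _ (f.chan_nonneg e d)), f.chan_lintegral e d hd]
  exact ENNReal.one_lt_top

theorem integral_chan (e : N.Link) {d : ℝ} (hd : 0 < d) : ∫ κ, f.chan e d κ = 1 := by
  rw [integral_eq_lintegral_of_nonneg_ae (ae_of_all _ (f.chan_nonneg e d))
    (f.measurable_chan e d).aestronglyMeasurable, f.chan_lintegral e d hd, ENNReal.toReal_one]

theorem measurable_chansDensity : Measurable (Function.uncurry fun (P : N.Pos) (κ : N.Chans) =>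
    ∏ e : N.Link, ENNReal.ofReal (f.chan e (N.dist e P) (κ e))) := by
  refine Finset.measurable_prod _ fun e _ => ENNReal.measurable_ofReal.comp ?_
  exact (f.chan_meas e).comp (((N.measurable_dist e).comp measurable_fst).prodMk
    ((measurable_pi_apply e).comp measurable_snd))

/-- Law of all channel parameters given the positions. -/
def chansKernel : Kernel N.Pos N.Chans :=
  Kernel.withDensity (Kernel.const _ volume) fun P κ =>
    ∏ e : N.Link, ENNReal.ofReal (f.chan e (N.dist e P) (κ e))

instance : IsSFiniteKernel f.chansKernel :=
  Kernel.IsSFiniteKernel.withDensity _ fun _ _ => ENNReal.prod_ne_top fun _ _ => ENNReal.ofReal_ne_top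

/-- Law of all channel parameters and the noise, given the positions. -/
def fibre : Kernel N.Pos (N.Chans × N.Obs) := f.chansKernel ×ₖ Kernel.const _ N.noise

instance : IsSFiniteKernel f.fibre := by unfold fibre; infer_instance

theorem chansKernel_apply {P : N.Pos} (hP : ∀ e, 0 < N.dist e P) :
    f.chansKernel P = Measure.pi fun e => f.chanLaw e (N.dist e P) := by
  rw [chansKernel, Kernel.withDensity_apply _ f.measurable_chansDensity, Kernel.const_apply]
  exact (pi_withDensity_ofReal (fun e : N.Link => f.chan e (N.dist e P))
    (fun e => f.chan_nonneg e _) fun e => f.integrable_chan e (hP e)).symm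

theorem fibre_apply {P : N.Pos} (hP : ∀ e, 0 < N.dist e P) :
    f.fibre P = (Measure.pi fun e => f.chanLaw e (N.dist e P)).prod
      (Measure.pi fun _ : N.Link => N.noise₁) := by
  rw [fibre, Kernel.prod_apply, Kernel.const_apply, f.chansKernel_apply hP]; rfl

theorem ofReal_paramPDF (θ : N.Param) : ENNReal.ofReal (f.paramPDF θ) =
    ENNReal.ofReal (f.pos θ.1) * ∏ e : N.Link, ENNReal.ofReal (f.chan e (N.dist e θ.1) (θ.2 e)) := by
  rw [paramPDF, ENNReal.ofReal_mul (f.pos_nonneg _),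
    ENNReal.ofReal_prod_of_nonneg fun e _ => f.chan_nonneg e _ _]

theorem paramLaw_eq : f.paramLaw = f.posLaw ⊗ₘ f.chansKernel := by
  have hp : Measurable fun P => ENNReal.ofReal (f.pos P) := f.pos_meas.ennreal_ofReal
  have h := withDensity_compProd_withDensity (volume : Measure N.Pos) (volume : Measure N.Chans) hp
    f.measurable_chansDensity fun _ _ => ENNReal.prod_ne_top fun _ _ => ENNReal.ofReal_ne_top
  rw [posLaw, chansKernel, h, paramLaw, Measure.volume_eq_prod]
  exact congrArg _ (funext f.ofReal_paramPDF)

/-- Disintegrates the joint law with the positions first, so that an expectation given `P` becomes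
an integral over `fibre P`. -/
theorem law_eq : MeasurePreserving
    (fun x : N.Pos × (N.Chans × N.Obs) => (((x.1, x.2.1), x.2.2) : N.Param × N.Obs))
    (f.posLaw ⊗ₘ f.fibre) f.law := by
  have hm : Measurable
      (fun x : N.Pos × (N.Chans × N.Obs) => (((x.1, x.2.1), x.2.2) : N.Param × N.Obs)) := by
    fun_prop
  refine ⟨hm, Measure.ext_of_lintegral _ fun g hg => ?_⟩
  rw [lintegral_map hg hm, Measure.lintegral_compProd (by fun_prop), law, paramLaw_eq,
    lintegral_prod _ (by fun_prop),
    Measure.lintegral_compProd (Measurable.lintegral_prod_right' hg)]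
  refine lintegral_congr fun P => ?_
  rw [fibre, Kernel.prod_apply, Kernel.const_apply, lintegral_prod _ (by fun_prop)]

theorem ae_fibre {p : N.Param × N.Obs → Prop} (h : ∀ᵐ ω ∂f.law, p ω) :
    ∀ᵐ P ∂f.posLaw, ∀ᵐ x ∂f.fibre P, p ((P, x.1), x.2) :=
  Measure.ae_ae_of_ae_compProd (f.law_eq.quasiMeasurePreserving.ae h)

theorem integrable_fibre {H : N.Param × N.Obs → ℝ} (h : Integrable H f.law) :
    ∀ᵐ P ∂f.posLaw, Integrable (fun x : N.Chans × N.Obs => H ((P, x.1), x.2)) (f.fibre P) :=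
  ((Measure.integrable_compProd_iff (f.law_eq.integrable_comp_of_integrable h).1).1
    (f.law_eq.integrable_comp_of_integrable h)).1

theorem integral_law {H : N.Param × N.Obs → ℝ} (h : Integrable H f.law) :
    ∫ ω, H ω ∂f.law = ∫ P, ∫ x : N.Chans × N.Obs, H ((P, x.1), x.2) ∂f.fibre P ∂f.posLaw := by
  have h1 := f.law_eq.integrable_comp_of_integrable h
  refine Eq.trans ?_ (Measure.integral_compProd h1)
  rw [← f.law_eq.map_eq]
  refine integral_map f.law_eq.measurable.aemeasurable ?_
  rw [f.law_eq.map_eq]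
  exact h.aestronglyMeasurable

theorem dist_pos_ae : ∀ᵐ P ∂f.posLaw, ∀ e : N.Link, 0 < N.dist e P :=
  f.posLaw_ac.ae_le (ae_all_iff.2 fun e => N.dist_pos_ae e)

/-- Resampling the channel parameters and noise of one waveform, given the positions. -/
theorem measurePreserving_resample {P : N.Pos} (hP : ∀ e, 0 < N.dist e P) (e : N.Link) :
    MeasurePreserving (fun w : (N.Chan e × (ℕ → ℝ)) × (N.Chans × N.Obs) =>
        (Function.update w.2.1 e w.1.1, Function.update w.2.2 e w.1.2))
      ((f.linkLaw e (N.dist e P)).prod (f.fibre P)) (f.fibre P) := by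
  have : ∀ e, IsProbabilityMeasure (f.chanLaw e (N.dist e P)) :=
    fun e => f.isProbabilityMeasure_chanLaw e (hP e)
  rw [f.fibre_apply hP, linkLaw_eq]
  exact ((measurePreserving_update (fun e => f.chanLaw e (N.dist e P)) e).prod
    (measurePreserving_update (E := fun _ : N.Link => ℕ → ℝ) (fun _ => N.noise₁) e)).comp
      (measurePreserving_prodProdComm _ _ _ _)

theorem isProbabilityMeasure_fibre {P : N.Pos} (hP : ∀ e, 0 < N.dist e P) :
    IsProbabilityMeasure (f.fibre P) := by
  have : ∀ e, IsProbabilityMeasure (f.chanLaw e (N.dist e P)) :=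
    fun e => f.isProbabilityMeasure_chanLaw e (hP e)
  rw [f.fibre_apply hP]; infer_instance

/-- An integral over the law of a quantity that depends on one waveform only. -/
theorem link_fibre {P : N.Pos} (hP : ∀ e, 0 < N.dist e P) (e : N.Link)
    {G : N.Chan e × (ℕ → ℝ) → ℝ}
    (h : Integrable (fun x : N.Chans × N.Obs => G (x.1 e, x.2 e)) (f.fibre P)) :
    Integrable G (f.linkLaw e (N.dist e P)) ∧
      ∫ x : N.Chans × N.Obs, G (x.1 e, x.2 e) ∂f.fibre P =
        ∫ w, G w ∂f.linkLaw e (N.dist e P) := by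
  have := f.isProbabilityMeasure_fibre hP
  have := f.isProbabilityMeasure_chanLaw e (hP e)
  have : SFinite (f.linkLaw e (N.dist e P)) := by rw [linkLaw_eq]; infer_instance
  exact integral_of_section (f.measurePreserving_resample hP e)
    (fun y z => by simp) h

theorem ae_link {P : N.Pos} (hP : ∀ e, 0 < N.dist e P) (e : N.Link)
    {p : N.Chan e × (ℕ → ℝ) → Prop} (h : ∀ᵐ x ∂f.fibre P, p (x.1 e, x.2 e)) :
    ∀ᵐ w ∂f.linkLaw e (N.dist e P), p w := by
  have := f.isProbabilityMeasure_fibre hP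
  have := f.isProbabilityMeasure_chanLaw e (hP e)
  have : SFinite (f.linkLaw e (N.dist e P)) := by rw [linkLaw_eq]; infer_instance
  exact ae_of_section (f.measurePreserving_resample hP e) (fun y z h => by simpa using h) h

theorem measurePreserving_pos : MeasurePreserving (fun ω : N.Param × N.Obs => ω.1.1)
    f.law f.posLaw := by
  refine ⟨by fun_prop, ?_⟩
  rw [← f.law_eq.map_eq, Measure.map_map (by fun_prop) f.law_eq.measurable]
  refine Measure.ext_of_lintegral _ fun g hg => ?_
  rw [lintegral_map hg (by fun_prop), Measure.lintegral_compProd (by fun_prop)]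
  refine lintegral_congr_ae ?_
  filter_upwards [f.dist_pos_ae] with P hP
  have := f.isProbabilityMeasure_fibre hP
  simp

end Prior

end CoopLoc

end

noncomputable section

namespace CoopLoc

/-! ### Second partial derivatives -/

section Calculus

variable {X Y : Type*} [NormedAddCommGroup X] [NormedSpace ℝ X] [NormedAddCommGroup Y]
  [NormedSpace ℝ Y]

theorem eventually_differentiableAt {F : X → Y} {x : X} (hF : ContDiffAt ℝ 2 F x) :
    ∀ᶠ y in 𝓝 x, DifferentiableAt ℝ F y :=
  (hF.eventually (by simp)).mono fun _ hy => hy.differentiableAt (by simp)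

theorem differentiableAt_fderiv {F : X → Y} {x : X} (hF : ContDiffAt ℝ 2 F x) :
    DifferentiableAt ℝ (fderiv ℝ F) x :=
  (hF.fderiv_right (m := 1) (by norm_num)).differentiableAt (by simp)

theorem partial₂_congr {F G : X → ℝ} {x : X} (h : F =ᶠ[𝓝 x] G) (u v : X) :
    partial₂ F u v x = partial₂ G u v x :=
  Filter.EventuallyEq.lineDeriv_eq (h.eventuallyEq_nhds.mono fun _ hy => hy.lineDeriv_eq)

/-- Iterated line derivatives become a bilinear form in the directions, which gives access to
linearity, symmetry and the chain rule. -/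
theorem partial₂_eq_fderiv {F : X → ℝ} {x : X} (hF : ContDiffAt ℝ 2 F x) (u v : X) :
    partial₂ F u v x = fderiv ℝ (fderiv ℝ F) x u v := by
  have h : (fun y => lineDeriv ℝ F y v) =ᶠ[𝓝 x] fun y => fderiv ℝ F y v :=
    (eventually_differentiableAt hF).mono fun y hy => hy.lineDeriv_eq_fderiv
  have h2 := (differentiableAt_fderiv hF).hasFDerivAt.clm_apply (hasFDerivAt_const v x)
  rw [partial₂, h.lineDeriv_eq, h2.differentiableAt.lineDeriv_eq_fderiv, h2.fderiv]
  simp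

theorem partial₂_symm {F : X → ℝ} {x : X} (hF : ContDiffAt ℝ 2 F x) (u v : X) :
    partial₂ F u v x = partial₂ F v u x := by
  rw [partial₂_eq_fderiv hF, partial₂_eq_fderiv hF]
  exact (hF.isSymmSndFDerivAt (by simp)) u v

theorem partial₂_comp {F : Y → ℝ} {φ : X → Y} {x : X} (hF : ContDiffAt ℝ 2 F (φ x))
    (hφ : ContDiffAt ℝ 2 φ x) (u v : X) :
    partial₂ (fun z => F (φ z)) u v x =
      fderiv ℝ (fderiv ℝ F) (φ x) (fderiv ℝ φ x u) (fderiv ℝ φ x v)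
        + fderiv ℝ F (φ x) (fderiv ℝ (fderiv ℝ φ) x u v) := by
  have hFφ : ContDiffAt ℝ 2 (fun z => F (φ z)) x := hF.comp x hφ
  have h1 : fderiv ℝ (fun z => F (φ z)) =ᶠ[𝓝 x]
      fun z => (fderiv ℝ F (φ z)).comp (fderiv ℝ φ z) := by
    filter_upwards [eventually_differentiableAt hφ,
      hφ.continuousAt.eventually (eventually_differentiableAt hF)] with z hz1 hz2
    exact fderiv_comp z hz2 hz1
  have h2 := (differentiableAt_fderiv hF).hasFDerivAt.comp x
    (hφ.differentiableAt (by simp)).hasFDerivAt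
  have h3 := h2.clm_comp (differentiableAt_fderiv hφ).hasFDerivAt
  rw [partial₂_eq_fderiv hFφ, h1.fderiv_eq]
  refine (congrArg (fun L => L u v) h3.fderiv).trans ?_
  simp [add_comm]

/-- Second derivatives of a sum of `F` at a range `ρ` and a vector of further parameters. -/
theorem partial₂_range {Z : Type*} [NormedAddCommGroup Z] [NormedSpace ℝ Z] {F : ℝ × Y → ℝ}
    {ρ : X → ℝ} (π : Z →L[ℝ] Y) {x : X × Z} (hF : ContDiffAt ℝ 2 F (ρ x.1, π x.2))
    (hρ : ContDiffAt ℝ 2 ρ x.1) (u v : X × Z) :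
    partial₂ (fun z : X × Z => F (ρ z.1, π z.2)) u v x =
      partial₂ F (fderiv ℝ ρ x.1 u.1, π u.2) (fderiv ℝ ρ x.1 v.1, π v.2) (ρ x.1, π x.2)
        + partial₂ ρ u.1 v.1 x.1 * lineDeriv ℝ F (ρ x.1, π x.2) (1, 0) := by
  have hφ : ContDiffAt ℝ 2 (fun z : X × Z => (ρ z.1, π z.2)) x :=
    (hρ.comp x contDiffAt_fst).prodMk (π.contDiff.contDiffAt.comp x contDiffAt_snd)
  have h1 : ∀ z : X × Z, DifferentiableAt ℝ ρ z.1 →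
      HasFDerivAt (fun z : X × Z => (ρ z.1, π z.2))
        (((fderiv ℝ ρ z.1).comp (ContinuousLinearMap.fst ℝ X Z)).prod
          (π.comp (ContinuousLinearMap.snd ℝ X Z))) z := fun z hz =>
    (hz.hasFDerivAt.comp z hasFDerivAt_fst).prodMk (π.hasFDerivAt.comp z hasFDerivAt_snd)
  have h2 : ∀ w : X × Z, fderiv ℝ (fun z : X × Z => (ρ z.1, π z.2)) x w =
      (fderiv ℝ ρ x.1 w.1, π w.2) := fun w => by
    rw [(h1 x (hρ.differentiableAt (by simp))).fderiv]; rfl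
  have h3 : fderiv ℝ (fderiv ℝ (fun z : X × Z => (ρ z.1, π z.2))) x u v =
      (partial₂ ρ u.1 v.1 x.1, 0) := by
    have h4 : (fun z => fderiv ℝ (fun z : X × Z => (ρ z.1, π z.2)) z v) =ᶠ[𝓝 x]
        fun z => (fderiv ℝ ρ z.1 v.1, π v.2) := by
      filter_upwards [continuousAt_fst.eventually (eventually_differentiableAt hρ)] with z hz
      rw [(h1 z hz).fderiv]; rfl
    have h5 := ((differentiableAt_fderiv hφ).hasFDerivAt.clm_apply
      (hasFDerivAt_const v x)).fderiv
    have h6 := (((differentiableAt_fderiv hρ).hasFDerivAt.comp x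
      (hasFDerivAt_fst (𝕜 := ℝ) (p := x))).clm_apply
      (hasFDerivAt_const v.1 x)).prodMk (hasFDerivAt_const (π v.2) x)
    have h7 := (h5.symm.trans h4.fderiv_eq).trans h6.fderiv
    have h8 := congrArg (fun L => L u) h7
    simpa [partial₂_eq_fderiv hρ] using h8
  rw [partial₂_comp (φ := fun z : X × Z => (ρ z.1, π z.2)) hF hφ, h2, h2, h3, partial₂_eq_fderiv hF,
    (hF.differentiableAt (by simp)).lineDeriv_eq_fderiv]
  congr 1
  rw [show ((partial₂ ρ u.1 v.1 x.1, 0) : ℝ × Y) = partial₂ ρ u.1 v.1 x.1 • ((1, 0) : ℝ × Y) by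
    simp, map_smul, smul_eq_mul]

end Calculus

/-! ### Ranges between nodes -/

variable {Na Nb : ℕ} (N : Network Na Nb)

namespace Network

/-- The sign with which the position of agent `k` enters the range of a waveform. -/
def sgn (e : N.Link) (k : Fin Na) : ℝ :=
  (if N.rx e = k then 1 else 0) - (if N.tx e = Sum.inl k then 1 else 0)

theorem sgn_rx (e : N.Link) : N.sgn e (N.rx e) = 1 := by
  simp [sgn, e.2.1]

/-- The linear part of the position of a node. -/
def nodeLin (j : Node Na Nb) : N.Pos →L[ℝ] Plane :=
  match j with
  | Sum.inl k => ContinuousLinearMap.proj k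
  | Sum.inr _ => 0

theorem nodePos_eq (j : Node Na Nb) (P : N.Pos) :
    N.nodePos P j = N.nodeLin j P + N.nodePos 0 j := by
  cases j <;> simp [nodePos, nodeLin]

/-- The linear part of the displacement between the nodes of a waveform. -/
def dispLin (e : N.Link) : N.Pos →L[ℝ] Plane :=
  N.nodeLin (Sum.inl (N.rx e)) - N.nodeLin (N.tx e)

theorem dist_eq (e : N.Link) (P : N.Pos) :
    N.dist e P = ‖N.dispLin e P - N.nodePos 0 (N.tx e)‖ := by
  rw [dist, N.nodePos_eq (Sum.inl _), N.nodePos_eq (N.tx e) P, dispLin,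
    sub_apply]
  congr 1
  simp only [nodePos, Pi.zero_apply]
  abel

theorem dispLin_single (e : N.Link) (k : Fin Na) (v : Plane) :
    N.dispLin e (Pi.single k v) = N.sgn e k • v := by
  obtain ⟨⟨r, t⟩, hne, hc⟩ := e
  cases t with
  | inl m =>
    have hmr : m ≠ r := fun h => hne (by simp [h])
    by_cases h1 : r = k
    · have h2 : m ≠ k := h1 ▸ hmr
      simp [dispLin, nodeLin, sgn, rx, tx, h1, h2]
    · by_cases h2 : m = k <;> simp [dispLin, nodeLin, sgn, rx, tx, h1, h2]
  | inr m =>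
    by_cases h1 : r = k <;> simp [dispLin, nodeLin, sgn, rx, tx, h1]

theorem contDiffAt_dist (e : N.Link) {P : N.Pos} (hP : 0 < N.dist e P) :
    ContDiffAt ℝ 2 (N.dist e) P := by
  rw [funext (N.dist_eq e)]
  rw [N.dist_eq, norm_pos_iff] at hP
  exact ((N.dispLin e).contDiff.contDiffAt.sub contDiffAt_const).norm ℝ hP

theorem hasFDerivAt_norm_plane {x : Plane} (hx : x ≠ 0) :
    HasFDerivAt (fun y : Plane => ‖y‖) (‖x‖⁻¹ • innerSL ℝ x) x := by
  have h1 := (hasStrictFDerivAt_norm_sq x).hasFDerivAt.sqrt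
    (pow_ne_zero 2 (norm_ne_zero_iff.2 hx))
  simp only [Real.sqrt_sq (norm_nonneg _)] at h1
  convert! h1 using 1
  ext y
  simp
  field_simp

theorem disp_eq (e : N.Link) (P : N.Pos) :
    N.nodePos P (Sum.inl (N.rx e)) - N.nodePos P (N.tx e) =
      N.dispLin e P - N.nodePos 0 (N.tx e) := by
  rw [N.nodePos_eq (Sum.inl _), N.nodePos_eq (N.tx e) P, dispLin,
    sub_apply]
  simp only [nodePos, Pi.zero_apply]
  abel

theorem fderiv_dist_single (e : N.Link) {P : N.Pos} (hP : 0 < N.dist e P) (k : Fin Na)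
    (v : Plane) : fderiv ℝ (N.dist e) P (Pi.single k v) = N.sgn e k * inner ℝ (N.q e P) v := by
  have hd := N.dist_eq e P
  rw [funext (N.dist_eq e)]
  have hx : N.dispLin e P - N.nodePos 0 (N.tx e) ≠ 0 := by
    rw [← norm_pos_iff, ← hd]; exact hP
  have h := (hasFDerivAt_norm_plane hx).comp P
    ((N.dispLin e).hasFDerivAt.sub_const (N.nodePos 0 (N.tx e)))
  refine (congrArg (fun L => L (Pi.single k v)) h.fderiv).trans ?_
  simp only [ContinuousLinearMap.comp_apply, smul_apply, innerSL_apply_apply, dispLin_single, q,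
    disp_eq, hd, real_inner_smul_left, real_inner_smul_right, smul_eq_mul]
  ring

theorem fderiv_dist_posDir (e : N.Link) {P : N.Pos} (hP : 0 < N.dist e P) (i : N.PosIdx) :
    fderiv ℝ (N.dist e) P (N.posDir i) = N.sgn e i.1 * N.q e P i.2 := by
  rw [posDir, N.fderiv_dist_single e hP]
  simp [EuclideanSpace.inner_single_right]

theorem norm_q (e : N.Link) {P : N.Pos} (hP : 0 < N.dist e P) : ‖N.q e P‖ = 1 := by
  have : ‖N.nodePos P (Sum.inl (N.rx e)) - N.nodePos P (N.tx e)‖ = N.dist e P := rfl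
  rw [q, norm_smul, this, norm_inv, Real.norm_of_nonneg hP.le, inv_mul_cancel₀ hP.ne']

theorem sum_q_sq (e : N.Link) {P : N.Pos} (hP : 0 < N.dist e P) :
    ∑ a, N.q e P a ^ 2 = 1 := by
  have h := EuclideanSpace.norm_sq_eq (N.q e P)
  rw [N.norm_q e hP] at h
  simpa using h.symm

/-- Moving the receiver along `q` only rescales the displacement, so the distance is affine along
this line. Hence its Hessian vanishes in the radial direction. -/
theorem dist_add_radial (e : N.Link) {P : N.Pos} (hP : 0 < N.dist e P) {t : ℝ}
    (ht : 0 < N.dist e P + t) :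
    N.dist e (P + t • (Pi.single (N.rx e) (N.q e P) : N.Pos)) = N.dist e P + t := by
  rw [N.dist_eq e (P + _), map_add, map_smul, dispLin_single, sgn_rx, one_smul,
    add_sub_right_comm, ← disp_eq]
  have : N.nodePos P (Sum.inl (N.rx e)) - N.nodePos P (N.tx e) = N.dist e P • N.q e P := by
    rw [q, smul_inv_smul₀ hP.ne']
  rw [this, ← add_smul, norm_smul, N.norm_q e hP, mul_one, Real.norm_of_nonneg ht.le]

theorem partial₂_dist_radial (e : N.Link) {P : N.Pos} (hP : 0 < N.dist e P) :
    partial₂ (N.dist e) (Pi.single (N.rx e) (N.q e P)) (Pi.single (N.rx e) (N.q e P)) P = 0 := by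
  set w : N.Pos := Pi.single (N.rx e) (N.q e P) with hw
  have h1 : (fun t : ℝ => lineDeriv ℝ (N.dist e) (P + t • w) w) =ᶠ[𝓝 0] fun _ => 1 := by
    have : ∀ᶠ t : ℝ in 𝓝 0, 0 < N.dist e P + t :=
      (continuous_const.add continuous_id).continuousAt.eventually_const_lt (by simpa using hP)
    filter_upwards [this] with t ht
    have h2 : (fun s : ℝ => N.dist e (P + t • w + s • w)) =ᶠ[𝓝 0] fun s => N.dist e P + t + s := by
      have : ∀ᶠ s : ℝ in 𝓝 0, 0 < N.dist e P + t + s :=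
        (continuous_const.add continuous_id).continuousAt.eventually_const_lt (by simpa using ht)
      filter_upwards [this] with s hs
      rw [add_assoc, ← add_smul, N.dist_add_radial e hP (by rwa [← add_assoc]), add_assoc]
    rw [lineDeriv, h2.deriv_eq]
    simp
  rw [partial₂, lineDeriv, h1.deriv_eq]
  simp

theorem sum_q_posDir (e : N.Link) (P : N.Pos) :
    ∑ a, N.q e P a • N.posDir (N.rx e, a) = Pi.single (N.rx e) (N.q e P) := by
  funext k
  by_cases hk : k = N.rx e
  · subst hk
    ext b
    fin_cases b <;> simp [posDir, Fin.sum_univ_two]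
  · simp [posDir, hk, Finset.sum_apply]

/-- Contracting the receiver's position block with `q` on both sides eliminates the score term; this
is used in `RegularAt.integral_pos_pos` to isolate the second derivative in `d`. -/
theorem sum_q_partial₂_dist (e : N.Link) {P : N.Pos} (hP : 0 < N.dist e P) :
    ∑ a, ∑ b, N.q e P a * N.q e P b *
      partial₂ (N.dist e) (N.posDir (N.rx e, a)) (N.posDir (N.rx e, b)) P = 0 := by
  have h := N.partial₂_dist_radial e hP
  have hC := N.contDiffAt_dist e hP
  rw [partial₂_eq_fderiv hC, ← sum_q_posDir] at h
  simp only [map_sum, map_smul, sum_apply, smul_apply,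
    smul_eq_mul, Finset.mul_sum] at h
  simp_rw [partial₂_eq_fderiv hC, mul_assoc]
  rw [← h, Finset.sum_comm]
  refine Finset.sum_congr rfl fun a _ => Finset.sum_congr rfl fun b _ => ?_
  ring

/-! ### Second derivatives of the contribution of one waveform -/

section Link

variable {N} {e : N.Link} {F : ℝ × N.Chan e → ℝ} {θ : N.Param}

theorem partial₂_link (hθ : 0 < N.dist e θ.1)
    (hF : ContDiffAt ℝ 2 F (N.dist e θ.1, θ.2 e)) (u v : N.Param) :
    partial₂ (fun θ : N.Param => F (N.dist e θ.1, θ.2 e)) u v θ =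
      partial₂ F (fderiv ℝ (N.dist e) θ.1 u.1, u.2 e) (fderiv ℝ (N.dist e) θ.1 v.1, v.2 e)
          (N.dist e θ.1, θ.2 e)
        + partial₂ (N.dist e) u.1 v.1 θ.1 * lineDeriv ℝ F (N.dist e θ.1, θ.2 e) (1, 0) :=
  partial₂_range (ContinuousLinearMap.proj (R := ℝ) (φ := fun e : N.Link => N.Chan e) e) hF
    (N.contDiffAt_dist e hθ) u v

theorem partial₂_link_pos_pos (hθ : 0 < N.dist e θ.1)
    (hF : ContDiffAt ℝ 2 F (N.dist e θ.1, θ.2 e)) (i j : N.PosIdx) :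
    partial₂ (fun θ : N.Param => F (N.dist e θ.1, θ.2 e)) (N.paramDir (Sum.inl i))
        (N.paramDir (Sum.inl j)) θ =
      N.sgn e i.1 * N.sgn e j.1 * (N.q e θ.1 i.2 * N.q e θ.1 j.2) *
          partial₂ F (N.linkDir e (Sum.inl ())) (N.linkDir e (Sum.inl ())) (N.dist e θ.1, θ.2 e)
        + partial₂ (N.dist e) (N.posDir i) (N.posDir j) θ.1 *
            lineDeriv ℝ F (N.dist e θ.1, θ.2 e) (1, 0) := by
  rw [partial₂_link hθ hF]
  simp only [paramDir, linkDir, N.fderiv_dist_posDir e hθ, Pi.zero_apply]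
  congr 1
  have h : ∀ c : ℝ, ((c, 0) : ℝ × N.Chan e) = c • (1, 0) := fun c => by simp
  rw [h, h (N.sgn e j.1 * _), partial₂_eq_fderiv hF, partial₂_eq_fderiv hF]
  simp only [map_smul, smul_apply, smul_eq_mul]
  ring

/-- No score term survives: the Hessian of the distance is evaluated with a channel direction, whose
position component is zero. -/
theorem partial₂_link_pos_chan (hθ : 0 < N.dist e θ.1)
    (hF : ContDiffAt ℝ 2 F (N.dist e θ.1, θ.2 e)) (i : N.PosIdx) (c : N.Coord e) :
    partial₂ (fun θ : N.Param => F (N.dist e θ.1, θ.2 e)) (N.paramDir (Sum.inl i))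
        (N.paramDir (Sum.inr ⟨e, c⟩)) θ =
      N.sgn e i.1 * N.q e θ.1 i.2 *
          partial₂ F (N.linkDir e (Sum.inl ())) (N.linkDir e (Sum.inr c)) (N.dist e θ.1, θ.2 e) := by
  rw [partial₂_link hθ hF]
  simp only [paramDir, linkDir, N.fderiv_dist_posDir e hθ, Pi.zero_apply, Pi.single_eq_same,
    map_zero]
  have h : ∀ c : ℝ, ((c, 0) : ℝ × N.Chan e) = c • (1, 0) := fun c => by simp
  rw [h, partial₂_eq_fderiv hF, partial₂_eq_fderiv hF,
    partial₂_eq_fderiv (N.contDiffAt_dist e hθ)]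
  simp only [map_smul, smul_apply, smul_eq_mul, map_zero, zero_mul, add_zero]

theorem partial₂_link_chan_chan (hθ : 0 < N.dist e θ.1)
    (hF : ContDiffAt ℝ 2 F (N.dist e θ.1, θ.2 e)) (c c' : N.Coord e) :
    partial₂ (fun θ : N.Param => F (N.dist e θ.1, θ.2 e)) (N.paramDir (Sum.inr ⟨e, c⟩))
        (N.paramDir (Sum.inr ⟨e, c'⟩)) θ =
      partial₂ F (N.linkDir e (Sum.inr c)) (N.linkDir e (Sum.inr c')) (N.dist e θ.1, θ.2 e) := by
  rw [partial₂_link hθ hF]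
  simp only [paramDir, linkDir, Pi.single_eq_same, map_zero]
  rw [partial₂_eq_fderiv (N.contDiffAt_dist e hθ)]
  simp

theorem partial₂_link_of_ne_right (hθ : 0 < N.dist e θ.1)
    (hF : ContDiffAt ℝ 2 F (N.dist e θ.1, θ.2 e)) (i : N.PosIdx ⊕ N.ChanIdx) (x : N.ChanIdx)
    (hx : x.1 ≠ e) :
    partial₂ (fun θ : N.Param => F (N.dist e θ.1, θ.2 e)) (N.paramDir i)
        (N.paramDir (Sum.inr x)) θ = 0 := by
  rw [partial₂_link hθ hF]
  simp only [paramDir, map_zero, Pi.single_eq_of_ne hx.symm]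
  rw [partial₂_eq_fderiv hF, partial₂_eq_fderiv (N.contDiffAt_dist e hθ)]
  rw [show ((0, 0) : ℝ × N.Chan e) = 0 from rfl]
  simp

theorem partial₂_link_of_ne_left (hθ : 0 < N.dist e θ.1)
    (hF : ContDiffAt ℝ 2 F (N.dist e θ.1, θ.2 e)) (x : N.ChanIdx) (j : N.PosIdx ⊕ N.ChanIdx)
    (hx : x.1 ≠ e) :
    partial₂ (fun θ : N.Param => F (N.dist e θ.1, θ.2 e)) (N.paramDir (Sum.inr x))
        (N.paramDir j) θ = 0 := by
  rw [partial₂_link hθ hF]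
  simp only [paramDir, map_zero, Pi.single_eq_of_ne hx.symm]
  rw [partial₂_eq_fderiv hF, partial₂_eq_fderiv (N.contDiffAt_dist e hθ)]
  rw [show ((0, 0) : ℝ × N.Chan e) = 0 from rfl]
  simp

end Link

end Network

end CoopLoc

end

noncomputable section

namespace CoopLoc

variable {Na Nb : ℕ} (N : Network Na Nb)

/-! ### Symmetry of the log-likelihood in the noise -/

namespace Network

theorem memLp_signal (e : N.Link) (d : ℝ) (κ : N.Chan e) :
    MemLp (N.signal e d κ) 2 (volume.restrict (Set.Ico 0 N.Tob)) := by
  refine MemLp.restrict _ ?_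
  unfold signal
  refine memLp_finsetSum _ fun l _ => MemLp.const_mul ?_ _
  exact N.s_memLp.comp_measurePreserving (measurePreserving_sub_right volume _)

/-- The noise-free waveform as an element of `L²`. -/
def sig (e : N.Link) (x : ℝ × N.Chan e) : Lp ℝ 2 (volume.restrict (Set.Ico 0 N.Tob)) :=
  (N.memLp_signal e x.1 x.2).toLp

/-- Identifies the coefficients as Hilbert basis coordinates in `L²`, so that Parseval's identity
applies. -/
theorem coef_eq_inner (e : N.Link) (x : ℝ × N.Chan e) (n : ℕ) :
    N.coef e x.1 x.2 n = inner ℝ (N.kl n) (N.sig e x) := by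
  rw [L2.inner_def, coef]
  refine integral_congr_ae ?_
  filter_upwards [(N.memLp_signal e x.1 x.2).coeFn_toLp] with t ht
  rw [sig, ht]
  simp

theorem integral_signal_sq (e : N.Link) (x : ℝ × N.Chan e) :
    ∫ t in Set.Ico 0 N.Tob, N.signal e x.1 x.2 t ^ 2 = ‖N.sig e x‖ ^ 2 := by
  rw [← real_inner_self_eq_norm_sq, L2.inner_def]
  refine integral_congr_ae ?_
  filter_upwards [(N.memLp_signal e x.1 x.2).coeFn_toLp] with t ht
  rw [sig, ht]
  simp

theorem log_lik (e : N.Link) (r : ℕ → ℝ) (x : ℝ × N.Chan e) :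
    Real.log (N.lik e r x) = 2 / N.N0 * N.corr e r x - 1 / N.N0 * ‖N.sig e x‖ ^ 2 := by
  rw [lik, Real.log_exp, integral_signal_sq]

theorem lik_pos (e : N.Link) (r : ℕ → ℝ) (x : ℝ × N.Chan e) : 0 < N.lik e r x :=
  Real.exp_pos _

theorem hasSum_coef_mul_coef (e : N.Link) (x y : ℝ × N.Chan e) :
    HasSum (fun n => N.coef e x.1 x.2 n * N.coef e y.1 y.2 n)
      (inner ℝ (N.sig e x) (N.sig e y)) := by
  have h := N.kl.hasSum_inner_mul_inner (N.sig e x) (N.sig e y)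
  refine h.congr_fun fun n => ?_
  rw [coef_eq_inner, coef_eq_inner, real_inner_comm]

/-- The noise cancels already in the partial sums, and Parseval evaluates what is left. -/
theorem corr_add_corr_neg (e : N.Link) {d : ℝ} {κ : N.Chan e} {z : ℕ → ℝ} {x : ℝ × N.Chan e}
    (h : ∃ l : ℝ, Tendsto (N.corrPartial e (N.recv₁ e d κ z) x) atTop (𝓝 l))
    (h' : ∃ l : ℝ, Tendsto (N.corrPartial e (N.recv₁ e d κ (-z)) x) atTop (𝓝 l)) :
    N.corr e (N.recv₁ e d κ z) x + N.corr e (N.recv₁ e d κ (-z)) x =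
      2 * inner ℝ (N.sig e (d, κ)) (N.sig e x) := by
  obtain ⟨l, hl⟩ := h
  obtain ⟨l', hl'⟩ := h'
  rw [corr, corr, hl.limUnder_eq, hl'.limUnder_eq]
  have h1 := ((N.hasSum_coef_mul_coef e (d, κ) x).tendsto_sum_nat).const_mul 2
  refine tendsto_nhds_unique (hl.add hl') (h1.congr fun M => ?_)
  rw [corrPartial, corrPartial, ← Finset.sum_add_distrib, Finset.mul_sum]
  refine Finset.sum_congr rfl fun n _ => ?_
  simp only [recv₁, Pi.neg_apply]
  ring

theorem log_lik_add_log_lik_neg (e : N.Link) {d : ℝ} {κ : N.Chan e} {z : ℕ → ℝ}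
    {x : ℝ × N.Chan e}
    (h : ∃ l : ℝ, Tendsto (N.corrPartial e (N.recv₁ e d κ z) x) atTop (𝓝 l))
    (h' : ∃ l : ℝ, Tendsto (N.corrPartial e (N.recv₁ e d κ (-z)) x) atTop (𝓝 l)) :
    Real.log (N.lik e (N.recv₁ e d κ z) x) + Real.log (N.lik e (N.recv₁ e d κ (-z)) x) =
      2 / N.N0 * (‖N.sig e (d, κ)‖ ^ 2 - ‖N.sig e (d, κ) - N.sig e x‖ ^ 2) := by
  rw [log_lik, log_lik, norm_sub_sq_real]
  linear_combination 2 / N.N0 * N.corr_add_corr_neg e h h'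

/-- The score of the range in the likelihood is an odd function of the noise. -/
theorem lineDeriv_log_lik_neg (e : N.Link) {d : ℝ} {κ : N.Chan e} {z : ℕ → ℝ}
    (h : ∀ᶠ x in 𝓝 (d, κ), ∃ l : ℝ,
      Tendsto (N.corrPartial e (N.recv₁ e d κ z) x) atTop (𝓝 l))
    (h' : ∀ᶠ x in 𝓝 (d, κ), ∃ l : ℝ,
      Tendsto (N.corrPartial e (N.recv₁ e d κ (-z)) x) atTop (𝓝 l))
    (hd : DifferentiableAt ℝ (N.lik e (N.recv₁ e d κ z)) (d, κ))
    (hd' : DifferentiableAt ℝ (N.lik e (N.recv₁ e d κ (-z))) (d, κ)) (v : ℝ × N.Chan e) :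
    lineDeriv ℝ (fun x => Real.log (N.lik e (N.recv₁ e d κ (-z)) x)) (d, κ) v =
      - lineDeriv ℝ (fun x => Real.log (N.lik e (N.recv₁ e d κ z) x)) (d, κ) v := by
  have hl := hd.log (N.lik_pos e _ _).ne'
  have hl' := hd'.log (N.lik_pos e _ _).ne'
  -- After completing the square, only `-‖sig (d, κ) - sig x‖²` depends on `x`, and it is maximal at
  -- `x = (d, κ)`. The maximum is local because the series converge only near the true point.
  have hmax : IsLocalMax (fun x => Real.log (N.lik e (N.recv₁ e d κ z) x)
      + Real.log (N.lik e (N.recv₁ e d κ (-z)) x)) (d, κ) := by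
    have hN := N.N0_pos
    filter_upwards [h, h'] with x hx hx'
    rw [N.log_lik_add_log_lik_neg e hx hx',
      N.log_lik_add_log_lik_neg e h.self_of_nhds h'.self_of_nhds]
    gcongr
    simp
  have h0 := congrArg (fun L => L v) hmax.fderiv_eq_zero
  rw [hl.lineDeriv_eq_fderiv, hl'.lineDeriv_eq_fderiv]
  have h1 := congrArg (fun L => L v) (hl.hasFDerivAt.add hl'.hasFDerivAt).fderiv
  have h2 := h1.symm.trans h0
  simp only [add_apply, zero_apply] at h2
  linarith

end Network

namespace Prior

variable {N} (f : Prior N)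

theorem measurePreserving_neg_linkLaw (e : N.Link) {d : ℝ} (hd : 0 < d) :
    MeasurePreserving (fun w : N.Chan e × (ℕ → ℝ) => (w.1, -w.2)) (f.linkLaw e d)
      (f.linkLaw e d) := by
  have := f.isProbabilityMeasure_chanLaw e hd
  rw [linkLaw_eq]
  exact (MeasurePreserving.id _).prod N.measurePreserving_neg_noise₁

/-- The integral of an odd function under a symmetric law equals its own negative. Integrability is
not required, since both identities used hold for the Bochner integral without it. -/
theorem integral_lineDeriv_log_lik (e : N.Link) {d : ℝ} (hd : 0 < d)
    (hconv : ∀ᵐ w ∂f.linkLaw e d, ∀ᶠ x in 𝓝 (d, w.1), ∃ l : ℝ,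
      Tendsto (N.corrPartial e (N.recv₁ e d w.1 w.2) x) atTop (𝓝 l))
    (hdiff : ∀ᵐ w ∂f.linkLaw e d, ContDiffAt ℝ 2 (N.lik e (N.recv₁ e d w.1 w.2)) (d, w.1))
    (v : ℝ × N.Chan e) :
    ∫ w, lineDeriv ℝ (fun x => Real.log (N.lik e (N.recv₁ e d w.1 w.2) x)) (d, w.1) v
      ∂f.linkLaw e d = 0 := by
  have hmp := f.measurePreserving_neg_linkLaw e hd
  have hemb : MeasurableEmbedding (fun w : N.Chan e × (ℕ → ℝ) => (w.1, -w.2)) :=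
    ((MeasurableEquiv.refl _).prodCongr (MeasurableEquiv.neg (ℕ → ℝ))).measurableEmbedding
  have h1 := hmp.integral_comp hemb fun w =>
    lineDeriv ℝ (fun x => Real.log (N.lik e (N.recv₁ e d w.1 w.2) x)) (d, w.1) v
  have h2 : ∫ w, lineDeriv ℝ (fun x => Real.log (N.lik e (N.recv₁ e d w.1 (-w.2)) x))
        (d, w.1) v ∂f.linkLaw e d =
      ∫ w, - lineDeriv ℝ (fun x => Real.log (N.lik e (N.recv₁ e d w.1 w.2) x)) (d, w.1) v
        ∂f.linkLaw e d := by
    refine integral_congr_ae ?_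
    filter_upwards [hconv, hdiff, hmp.quasiMeasurePreserving.ae hconv,
      hmp.quasiMeasurePreserving.ae hdiff] with w hw1 hw2 hw3 hw4
    exact N.lineDeriv_log_lik_neg e hw1 hw3 (hw2.differentiableAt (by simp))
      (hw4.differentiableAt (by simp)) v
  rw [integral_neg] at h2
  linarith [h1.symm.trans h2]

/-! ### The score of the channel densities -/

theorem chan_pos_ae (e : N.Link) (d : ℝ) : ∀ᵐ κ ∂f.chanLaw e d, 0 < f.chan e d κ := by
  rw [chanLaw, ae_withDensity_iff (f.measurable_chan e d).ennreal_ofReal]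
  exact ae_of_all _ fun κ h => ENNReal.ofReal_pos.1 (pos_iff_ne_zero.2 h)

variable {f}

/-- The total mass is 1 for all distances near `d`, and domination allows differentiation under the
integral. -/
theorem Regular.integral_deriv_chan (hreg : f.Regular) (e : N.Link) {d : ℝ} (hd : 0 < d) :
    Integrable (fun κ => deriv (fun d' => f.chan e d' κ) d) ∧
      ∫ κ, deriv (fun d' => f.chan e d' κ) d = 0 := by
  obtain ⟨ε, hε, g, hg, hdom⟩ := hreg.chan_dominated e d hd
  -- The derivative is an almost everywhere limit of difference quotients with step `1 / (n + 1)`,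
  -- each measurable in `κ`.
  have hmeas : AEStronglyMeasurable (fun κ => deriv (fun d' => f.chan e d' κ) d) := by
    refine aestronglyMeasurable_of_tendsto_ae atTop
      (f := fun (n : ℕ) κ => (1 / ((n : ℝ) + 1))⁻¹ •
        (f.chan e (d + 1 / ((n : ℝ) + 1)) κ - f.chan e d κ)) (fun n => ?_) ?_
    · have h1 : Measurable fun κ => f.chan e (d + 1 / ((n : ℝ) + 1)) κ - f.chan e d κ :=
        (f.measurable_chan e _).sub (f.measurable_chan e _)
      exact (h1.const_smul (1 / ((n : ℝ) + 1))⁻¹).aestronglyMeasurable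
    · filter_upwards [hdom] with κ hκ
      have h1 := (hκ d (Metric.mem_ball_self hε)).1.hasDerivAt.tendsto_slope_zero
      refine h1.comp (tendsto_nhdsWithin_iff.2 ⟨tendsto_one_div_add_atTop_nhds_zero_nat, ?_⟩)
      exact Eventually.of_forall fun n => by
        have : (0 : ℝ) < 1 / ((n : ℝ) + 1) := by positivity
        exact this.ne'
  have h := hasDerivAt_integral_of_dominated_loc_of_deriv_le (μ := volume)
    (F := fun d' κ => f.chan e d' κ) (F' := fun d κ => deriv (fun d' => f.chan e d' κ) d)
    (Metric.ball_mem_nhds d hε)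
    (Eventually.of_forall fun d' => (f.measurable_chan e d').aestronglyMeasurable)
    (f.integrable_chan e hd) hmeas
    (hdom.mono fun κ hκ d' hd' => (hκ d' hd').2) hg
    (hdom.mono fun κ hκ d' hd' => (hκ d' hd').1.hasDerivAt)
  refine ⟨h.1, ?_⟩
  have h2 : (fun d' => ∫ κ, f.chan e d' κ) =ᶠ[𝓝 d] fun _ => 1 :=
    (eventually_gt_nhds hd).mono fun d' hd' => f.integral_chan e hd'
  rw [← h.2.deriv, h2.deriv_eq]
  simp

theorem Regular.integral_lineDeriv_log_chan (hreg : f.Regular) (e : N.Link) {d : ℝ}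
    (hd : 0 < d) :
    Integrable (fun κ => lineDeriv ℝ (fun x : ℝ × N.Chan e => Real.log (f.chan e x.1 x.2))
        (d, κ) (1, 0)) (f.chanLaw e d) ∧
      ∫ κ, lineDeriv ℝ (fun x : ℝ × N.Chan e => Real.log (f.chan e x.1 x.2)) (d, κ) (1, 0)
        ∂f.chanLaw e d = 0 := by
  obtain ⟨ε, hε, g, hg, hdom⟩ := hreg.chan_dominated e d hd
  have key : (fun κ => (ENNReal.ofReal (f.chan e d κ)).toReal •
      lineDeriv ℝ (fun x : ℝ × N.Chan e => Real.log (f.chan e x.1 x.2)) (d, κ) (1, 0)) =ᵐ[volume]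
      fun κ => deriv (fun d' => f.chan e d' κ) d := by
    filter_upwards [hdom] with κ hκ
    have h1 := (hκ d (Metric.mem_ball_self hε)).1.hasDerivAt
    rw [ENNReal.toReal_ofReal (f.chan_nonneg e d κ)]
    -- Where the density vanishes it is at a minimum in `d`, so its derivative is zero too and the
    -- identity holds whatever value the logarithm takes there.
    rcases (f.chan_nonneg e d κ).eq_or_lt with h0 | hpos
    · have hmin : IsLocalMin (fun d' => f.chan e d' κ) d :=
        Eventually.of_forall fun d' => h0.symm.trans_le (f.chan_nonneg e d' κ)
      rw [hmin.deriv_eq_zero, ← h0, zero_smul]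
    · have h2 := h1.log hpos.ne'
      have h3 : HasDerivAt (fun t : ℝ => Real.log (f.chan e (d + t) κ))
          (deriv (fun d' => f.chan e d' κ) d / f.chan e d κ) 0 := by
        refine HasDerivAt.comp_const_add (f := fun y => Real.log (f.chan e y κ)) d 0 ?_
        simpa using h2
      have h4 : lineDeriv ℝ (fun x : ℝ × N.Chan e => Real.log (f.chan e x.1 x.2)) (d, κ) (1, 0)
          = deriv (fun d' => f.chan e d' κ) d / f.chan e d κ := by
        rw [← h3.deriv, lineDeriv]
        simp
      rw [h4, smul_eq_mul, mul_div_cancel₀ _ hpos.ne']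
  have hm := (f.measurable_chan e d).ennreal_ofReal
  have hlt : ∀ᵐ κ, ENNReal.ofReal (f.chan e d κ) < ∞ := ae_of_all _ fun _ => ENNReal.ofReal_lt_top
  obtain ⟨h1, h2⟩ := hreg.integral_deriv_chan e hd
  refine ⟨?_, ?_⟩
  · rw [chanLaw, integrable_withDensity_iff_integrable_smul' hm hlt]
    exact h1.congr key.symm
  · rw [chanLaw, integral_withDensity_eq_integral_toReal_smul hm hlt, integral_congr_ae key, h2]

/-- The mean score of the range vanishes. -/
theorem Regular.integral_lineDeriv_linkLog (hreg : f.Regular) (e : N.Link) {d : ℝ} (hd : 0 < d)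
    (hconv : ∀ᵐ w ∂f.linkLaw e d, ∀ᶠ x in 𝓝 (d, w.1), ∃ l : ℝ,
      Tendsto (N.corrPartial e (N.recv₁ e d w.1 w.2) x) atTop (𝓝 l))
    (hlik : ∀ᵐ w ∂f.linkLaw e d, ContDiffAt ℝ 2 (N.lik e (N.recv₁ e d w.1 w.2)) (d, w.1))
    (hchan : ∀ᵐ w ∂f.linkLaw e d, ContDiffAt ℝ 2 (Function.uncurry (f.chan e)) (d, w.1)) :
    ∫ w, lineDeriv ℝ (f.linkLog e (N.recv₁ e d w.1 w.2)) (d, w.1) (1, 0) ∂f.linkLaw e d = 0 := by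
  have := f.isProbabilityMeasure_chanLaw e hd
  obtain ⟨hint, hzero⟩ := hreg.integral_lineDeriv_log_chan e hd
  have hint' : Integrable (fun w : N.Chan e × (ℕ → ℝ) => lineDeriv ℝ
      (fun x : ℝ × N.Chan e => Real.log (f.chan e x.1 x.2)) (d, w.1) (1, 0)) (f.linkLaw e d) :=
    hint.comp_fst N.noise₁
  have hpos : ∀ᵐ w ∂f.linkLaw e d, 0 < f.chan e d w.1 := by
    rw [linkLaw_eq]
    exact Measure.quasiMeasurePreserving_fst.ae (f.chan_pos_ae e d)
  have hsum : (fun w : N.Chan e × (ℕ → ℝ) =>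
      lineDeriv ℝ (f.linkLog e (N.recv₁ e d w.1 w.2)) (d, w.1) (1, 0)) =ᵐ[f.linkLaw e d]
      fun w => lineDeriv ℝ (fun x => Real.log (N.lik e (N.recv₁ e d w.1 w.2) x)) (d, w.1) (1, 0)
        + lineDeriv ℝ (fun x : ℝ × N.Chan e => Real.log (f.chan e x.1 x.2)) (d, w.1) (1, 0) := by
    filter_upwards [hlik, hchan, hpos] with w h1 h2 h3
    have h4 := (h1.differentiableAt (by simp)).log (N.lik_pos e _ _).ne'
    have h5 : DifferentiableAt ℝ (fun x : ℝ × N.Chan e => Real.log (f.chan e x.1 x.2)) (d, w.1) :=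
      (h2.differentiableAt (by simp)).log h3.ne'
    rw [h4.lineDeriv_eq_fderiv, h5.lineDeriv_eq_fderiv]
    have h6 := h4.hasFDerivAt.add h5.hasFDerivAt
    exact h6.hasLineDerivAt (1, 0) |>.lineDeriv
  by_cases hI : Integrable (fun w : N.Chan e × (ℕ → ℝ) =>
      lineDeriv ℝ (f.linkLog e (N.recv₁ e d w.1 w.2)) (d, w.1) (1, 0)) (f.linkLaw e d)
  · have hI2 : Integrable (fun w : N.Chan e × (ℕ → ℝ) =>
        lineDeriv ℝ (fun x => Real.log (N.lik e (N.recv₁ e d w.1 w.2) x)) (d, w.1) (1, 0))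
        (f.linkLaw e d) := by
      refine (hI.sub hint').congr ?_
      filter_upwards [hsum] with w hw
      simp [hw]
    rw [integral_congr_ae hsum, integral_add hI2 hint',
      f.integral_lineDeriv_log_lik e hd hconv hlik, zero_add, linkLaw_eq,
      integral_fun_fst (fun κ => lineDeriv ℝ
        (fun x : ℝ × N.Chan e => Real.log (f.chan e x.1 x.2)) (d, κ) (1, 0)), hzero, smul_zero]
  -- A non-integrable score has Bochner integral 0 by convention. This is harmless: in
  -- `RegularAt.integral_pos_pos` the score appears with a factor that is zero unless the score is
  -- integrable.
  · exact integral_undef hI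

end Prior

end CoopLoc

end

noncomputable section

namespace CoopLoc

/-! ### Second partial derivatives in zero directions and of sums. -/

theorem partial₂_zero_dir_left {E : Type*} [AddCommGroup E] [Module ℝ E] (F : E → ℝ) (v x : E) :
    partial₂ F 0 v x = 0 := by
  simp [partial₂, lineDeriv]

theorem partial₂_zero_dir_right {E : Type*} [AddCommGroup E] [Module ℝ E] (F : E → ℝ) (u x : E) :
    partial₂ F u 0 x = 0 := by
  simp [partial₂, lineDeriv]

section Calculus

variable {X : Type*} [NormedAddCommGroup X] [NormedSpace ℝ X]

theorem partial₂_add {F G : X → ℝ} {x : X} (hF : ContDiffAt ℝ 2 F x) (hG : ContDiffAt ℝ 2 G x)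
    (u v : X) : partial₂ (fun y => F y + G y) u v x = partial₂ F u v x + partial₂ G u v x := by
  have h : fderiv ℝ (fun y => F y + G y) =ᶠ[𝓝 x] fun y => fderiv ℝ F y + fderiv ℝ G y := by
    filter_upwards [eventually_differentiableAt hF, eventually_differentiableAt hG] with y h1 h2
    exact (h1.hasFDerivAt.add h2.hasFDerivAt).fderiv
  rw [partial₂_eq_fderiv (hF.add hG), partial₂_eq_fderiv hF, partial₂_eq_fderiv hG]
  refine (congrArg (fun L : X →L[ℝ] X →L[ℝ] ℝ => L u v) h.fderiv_eq).trans ?_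
  exact congrArg (fun L : X →L[ℝ] X →L[ℝ] ℝ => L u v)
    ((differentiableAt_fderiv hF).hasFDerivAt.add (differentiableAt_fderiv hG).hasFDerivAt).fderiv

theorem partial₂_sum {ι : Type*} (s : Finset ι) {F : ι → X → ℝ} {x : X}
    (hF : ∀ i ∈ s, ContDiffAt ℝ 2 (F i) x) (u v : X) :
    partial₂ (fun y => ∑ i ∈ s, F i y) u v x = ∑ i ∈ s, partial₂ (F i) u v x := by
  classical
  induction s using Finset.induction_on with
  | empty => simp [partial₂, lineDeriv]
  | insert a s ha ih =>
    simp only [Finset.sum_insert ha]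
    rw [partial₂_add (hF a (Finset.mem_insert_self a s))
      (ContDiffAt.sum fun i hi => hF i (Finset.mem_insert_of_mem hi)),
      ih fun i hi => hF i (Finset.mem_insert_of_mem hi)]

end Calculus

variable {Na Nb : ℕ} {N : Network Na Nb}

namespace Prior

variable (f : Prior N)

/-! ### Regular points of the model -/

/-- A density is nonzero almost everywhere for its own law, which makes the logarithms legitimate.
-/
theorem paramPDF_pos_ae : ∀ᵐ θ ∂f.paramLaw,
    0 < f.pos θ.1 ∧ ∀ e : N.Link, 0 < f.chan e (N.dist e θ.1) (θ.2 e) := by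
  have hm : Measurable fun θ => ENNReal.ofReal (f.paramPDF θ) := by
    simp_rw [ofReal_paramPDF]
    exact (f.pos_meas.ennreal_ofReal.comp measurable_fst).mul f.measurable_chansDensity
  rw [paramLaw, ae_withDensity_iff hm]
  refine ae_of_all _ fun θ h => ?_
  rw [ofReal_paramPDF, mul_ne_zero_iff, Finset.prod_ne_zero_iff] at h
  exact ⟨ENNReal.ofReal_pos.1 (pos_iff_ne_zero.2 h.1), fun e =>
    ENNReal.ofReal_pos.1 (pos_iff_ne_zero.2 (h.2 e (Finset.mem_univ e)))⟩

theorem ae_law_of_paramLaw {p : N.Param → Prop} (h : ∀ᵐ θ ∂f.paramLaw, p θ) :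
    ∀ᵐ ω ∂f.law, p ω.1 :=
  Measure.quasiMeasurePreserving_fst.ae h

theorem ae_law_of_posLaw {p : N.Pos → Prop} (h : ∀ᵐ P ∂f.posLaw, p P) :
    ∀ᵐ ω ∂f.law, p ω.1.1 :=
  f.measurePreserving_pos.quasiMeasurePreserving.ae h

variable {f}

theorem contDiffAt_linkLog {e : N.Link} {r : ℕ → ℝ} {x : ℝ × N.Chan e}
    (h1 : ContDiffAt ℝ 2 (N.lik e r) x) (h2 : ContDiffAt ℝ 2 (Function.uncurry (f.chan e)) x)
    (h3 : 0 < f.chan e x.1 x.2) : ContDiffAt ℝ 2 (f.linkLog e r) x :=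
  (h1.log (N.lik_pos e r x).ne').add (h2.log h3.ne')

theorem Regular.contDiffAt_linkLog_ae (hreg : f.Regular) : ∀ᵐ ω ∂f.law, ∀ e : N.Link,
    ContDiffAt ℝ 2 (f.linkLog e (N.recv ω.1 ω.2 e)) (N.dist e ω.1.1, ω.1.2 e) := by
  filter_upwards [f.ae_law_of_paramLaw f.paramPDF_pos_ae,
    f.ae_law_of_paramLaw (ae_all_iff.2 hreg.chan_contDiffAt),
    ae_all_iff.2 hreg.lik_contDiffAt] with ω h1 h2 h3 e
  exact contDiffAt_linkLog (h3 e) (h2 e) (h1.2 e)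

theorem log_jointPDF {r : N.Obs} {θ : N.Param} (h1 : 0 < f.pos θ.1)
    (h2 : ∀ e : N.Link, 0 < f.chan e (N.dist e θ.1) (θ.2 e)) :
    Real.log (f.jointPDF r θ) =
      Real.log (f.pos θ.1) + ∑ e : N.Link, f.linkLog e (r e) (N.dist e θ.1, θ.2 e) := by
  have h3 : ∀ e : N.Link, N.lik e (r e) (N.dist e θ.1, θ.2 e) ≠ 0 :=
    fun e => (N.lik_pos e _ _).ne'
  have h4 : ∀ e : N.Link, f.chan e (N.dist e θ.1) (θ.2 e) ≠ 0 := fun e => (h2 e).ne'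
  rw [jointPDF, paramPDF, Real.log_mul (Finset.prod_ne_zero_iff.2 fun e _ => h3 e)
      (mul_ne_zero h1.ne' (Finset.prod_ne_zero_iff.2 fun e _ => h4 e)),
    Real.log_mul h1.ne' (Finset.prod_ne_zero_iff.2 fun e _ => h4 e),
    Real.log_prod fun e _ => h3 e, Real.log_prod fun e _ => h4 e]
  simp only [linkLog, Finset.sum_add_distrib]
  ring

/-- At almost every point the Hessian of the joint log-density is the sum of those of the
position density and of the contributions of the waveforms. -/
theorem Regular.partial₂_log_jointPDF (hreg : f.Regular) : ∀ᵐ ω ∂f.law, ∀ u v : N.Param,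
    partial₂ (fun θ => Real.log (f.jointPDF (N.recv ω.1 ω.2) θ)) u v ω.1 =
      partial₂ (fun P => Real.log (f.pos P)) u.1 v.1 ω.1.1 +
        ∑ e : N.Link, partial₂
          (fun θ : N.Param => f.linkLog e (N.recv ω.1 ω.2 e) (N.dist e θ.1, θ.2 e)) u v ω.1 := by
  filter_upwards [f.ae_law_of_paramLaw f.paramPDF_pos_ae,
    f.ae_law_of_paramLaw (ae_all_iff.2 hreg.chan_contDiffAt),
    f.ae_law_of_posLaw hreg.pos_contDiffAt, hreg.contDiffAt_linkLog_ae,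
    f.ae_law_of_posLaw f.dist_pos_ae] with ω hpos hchan hposC hlink hdist u v
  have hφ : ∀ e : N.Link, ContDiffAt ℝ 2 (fun θ : N.Param => (N.dist e θ.1, θ.2 e)) ω.1 :=
    fun e => ((N.contDiffAt_dist e (hdist e)).comp ω.1 contDiffAt_fst).prodMk
      ((ContinuousLinearMap.proj (R := ℝ) (φ := fun e : N.Link => N.Chan e)
        e).contDiff.contDiffAt.comp ω.1 contDiffAt_snd)
  have hC : ∀ e : N.Link, ContDiffAt ℝ 2
      (fun θ : N.Param => f.linkLog e (N.recv ω.1 ω.2 e) (N.dist e θ.1, θ.2 e)) ω.1 :=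
    fun e => ContDiffAt.comp (g := f.linkLog e (N.recv ω.1 ω.2 e)) ω.1 (hlink e) (hφ e)
  have hP : ContDiffAt ℝ 2 (fun θ : N.Param => Real.log (f.pos θ.1)) ω.1 :=
    ContDiffAt.comp (g := fun P => Real.log (f.pos P)) ω.1 (hposC.log hpos.1.ne') contDiffAt_fst
  -- Positivity spreads to a neighbourhood by continuity; splitting the logarithm at the point alone
  -- would not determine derivatives.
  have h1 : ∀ᶠ θ : N.Param in 𝓝 ω.1, 0 < f.pos θ.1 :=
    (continuousAt_fst (p := ω.1)).eventually (hposC.continuousAt.eventually_const_lt hpos.1)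
  have h2 : ∀ᶠ θ : N.Param in 𝓝 ω.1, ∀ e : N.Link, 0 < f.chan e (N.dist e θ.1) (θ.2 e) :=
    eventually_all.2 fun e => (hφ e).continuousAt.eventually
      ((hchan e).continuousAt.eventually_const_lt (hpos.2 e))
  have heq : (fun θ => Real.log (f.jointPDF (N.recv ω.1 ω.2) θ)) =ᶠ[𝓝 ω.1]
      fun θ => Real.log (f.pos θ.1) +
        ∑ e : N.Link, f.linkLog e (N.recv ω.1 ω.2 e) (N.dist e θ.1, θ.2 e) := by
    filter_upwards [h1, h2] with θ h3 h4
    exact log_jointPDF h3 h4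
  rw [partial₂_congr heq, partial₂_add hP (ContDiffAt.sum fun e _ => hC e),
    partial₂_sum _ fun e _ => hC e]
  rfl

variable (f)

/-- The contribution of one waveform to the Fisher information matrix. -/
def linkFisher (e : N.Link) (i j : N.PosIdx ⊕ N.ChanIdx) : ℝ :=
  ∫ ω, - partial₂ (fun θ : N.Param => f.linkLog e (N.recv ω.1 ω.2 e) (N.dist e θ.1, θ.2 e))
    (N.paramDir i) (N.paramDir j) ω.1 ∂f.law

variable {f}

theorem Regular.integral_pos_term (hreg : f.Regular) (i j : N.PosIdx ⊕ N.ChanIdx) :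
    Integrable (fun ω : N.Param × N.Obs => partial₂ (fun P => Real.log (f.pos P))
      (N.paramDir i).1 (N.paramDir j).1 ω.1.1) f.law ∧
    ∫ ω, - partial₂ (fun P => Real.log (f.pos P)) (N.paramDir i).1 (N.paramDir j).1 ω.1.1 ∂f.law =
      Matrix.fromBlocks f.Xi 0 0 0 i j := by
  rcases i with i | i <;> rcases j with j | j
  · have hI := hreg.pos_integrable i j
    refine ⟨f.measurePreserving_pos.integrable_comp_of_integrable hI, ?_⟩
    have hm := hI.neg.aestronglyMeasurable
    rw [← f.measurePreserving_pos.map_eq] at hm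
    have h := integral_map f.measurePreserving_pos.measurable.aemeasurable hm
    rw [f.measurePreserving_pos.map_eq] at h
    exact h.symm
  all_goals simp [Network.paramDir, partial₂_zero_dir_left, partial₂_zero_dir_right]

theorem Regular.fisher_eq (hreg : f.Regular) (i j : N.PosIdx ⊕ N.ChanIdx) :
    f.fisher i j = Matrix.fromBlocks f.Xi 0 0 0 i j + ∑ e : N.Link, f.linkFisher e i j := by
  obtain ⟨h1, h2⟩ := hreg.integral_pos_term i j
  rw [fisher, Matrix.of_apply, ← h2]
  have hneg : ∀ e : N.Link, Integrable (fun ω : N.Param × N.Obs => - partial₂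
      (fun θ : N.Param => f.linkLog e (N.recv ω.1 ω.2 e) (N.dist e θ.1, θ.2 e))
      (N.paramDir i) (N.paramDir j) ω.1) f.law := fun e => (hreg.link_integrable e i j).neg
  simp only [linkFisher]
  rw [← integral_finsetSum _ fun e _ => hneg e]
  refine Eq.trans ?_ (integral_add h1.neg (integrable_finsetSum _ fun e _ => hneg e))
  refine integral_congr_ae ?_
  filter_upwards [hreg.partial₂_log_jointPDF] with ω hω
  simp only [hω, Finset.sum_neg_distrib]
  ring

/-! ### The contribution of one waveform -/

/-- Regularity of the model given the positions. -/
structure RegularAt (f : Prior N) (e : N.Link) (P : N.Pos) : Prop where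
  dist_pos : ∀ e, 0 < N.dist e P
  contDiffAt : ∀ᵐ x ∂f.fibre P,
    ContDiffAt ℝ 2 (f.linkLog e (N.recv₁ e (N.dist e P) (x.1 e) (x.2 e))) (N.dist e P, x.1 e)
  integrable : ∀ i j : N.PosIdx ⊕ N.ChanIdx, Integrable (fun x : N.Chans × N.Obs => partial₂
    (fun θ : N.Param => f.linkLog e (N.recv₁ e (N.dist e P) (x.1 e) (x.2 e))
      (N.dist e θ.1, θ.2 e)) (N.paramDir i) (N.paramDir j) (P, x.1)) (f.fibre P)
  score : ∫ w, lineDeriv ℝ (f.linkLog e (N.recv₁ e (N.dist e P) w.1 w.2)) (N.dist e P, w.1) (1, 0)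
    ∂f.linkLaw e (N.dist e P) = 0

/-- Fubini passes every almost sure or integrability assumption on the joint law to almost every
fibre. -/
theorem Regular.regularAt (hreg : f.Regular) (e : N.Link) : ∀ᵐ P ∂f.posLaw, f.RegularAt e P := by
  filter_upwards [f.dist_pos_ae, f.ae_fibre hreg.contDiffAt_linkLog_ae,
    ae_all_iff.2 fun i => ae_all_iff.2 fun j => f.integrable_fibre (hreg.link_integrable e i j),
    f.ae_fibre (hreg.lik_convergent e), f.ae_fibre (hreg.lik_contDiffAt e),
    f.ae_fibre (f.ae_law_of_paramLaw (hreg.chan_contDiffAt e))] with P h1 h2 h3 h4 h5 h6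
  refine ⟨h1, h2.mono fun x hx => hx e, h3, ?_⟩
  refine hreg.integral_lineDeriv_linkLog e (h1 e) ?_ ?_ ?_
  · exact f.ae_link h1 e h4
  · exact f.ae_link h1 e h5
  · exact f.ae_link (p := fun w => ContDiffAt ℝ 2 (Function.uncurry (f.chan e)) (N.dist e P, w.1))
      h1 e h6

namespace RegularAt

variable {e : N.Link} {P : N.Pos}

/-- The integrand is a multiple of `D₂`, whose mean is `-Phi`, plus a multiple of the score `D₁`,
whose mean is zero. Regularity makes only the combinations integrable, so the two parts have to be
separated first. -/
theorem integral_pos_pos (h : f.RegularAt e P) (i j : N.PosIdx) :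
    ∫ x : N.Chans × N.Obs, - partial₂
        (fun θ : N.Param => f.linkLog e (N.recv₁ e (N.dist e P) (x.1 e) (x.2 e))
          (N.dist e θ.1, θ.2 e)) (N.paramDir (Sum.inl i)) (N.paramDir (Sum.inl j)) (P, x.1)
        ∂f.fibre P =
      N.sgn e i.1 * N.sgn e j.1 *
        (f.Phi e (Sum.inl ()) (Sum.inl ()) (N.dist e P) * (N.q e P i.2 * N.q e P j.2)) := by
  set S : N.PosIdx → N.PosIdx → N.Chans × N.Obs → ℝ := fun i j x => partial₂
    (fun θ : N.Param => f.linkLog e (N.recv₁ e (N.dist e P) (x.1 e) (x.2 e))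
      (N.dist e θ.1, θ.2 e)) (N.paramDir (Sum.inl i)) (N.paramDir (Sum.inl j)) (P, x.1)
  set D₂ : N.Chan e × (ℕ → ℝ) → ℝ := fun w =>
    partial₂ (f.linkLog e (N.recv₁ e (N.dist e P) w.1 w.2)) (N.linkDir e (Sum.inl ()))
      (N.linkDir e (Sum.inl ())) (N.dist e P, w.1)
  set D₁ : N.Chan e × (ℕ → ℝ) → ℝ := fun w =>
    lineDeriv ℝ (f.linkLog e (N.recv₁ e (N.dist e P) w.1 w.2)) (N.dist e P, w.1) (1, 0)
  have hform : ∀ᵐ x ∂f.fibre P, ∀ i j : N.PosIdx, S i j x =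
      N.sgn e i.1 * N.sgn e j.1 * (N.q e P i.2 * N.q e P j.2) * D₂ (x.1 e, x.2 e)
        + partial₂ (N.dist e) (N.posDir i) (N.posDir j) P * D₁ (x.1 e, x.2 e) := by
    filter_upwards [h.contDiffAt] with x hx i j
    exact Network.partial₂_link_pos_pos (θ := (P, x.1)) (h.dist_pos e) hx i j
  have hSI : ∀ i j, Integrable (S i j) (f.fibre P) :=
    fun i j => h.integrable (Sum.inl i) (Sum.inl j)
  -- The radial contraction of the integrable entries `S` is exactly `D₂`: the signs at the receiver
  -- are 1 and the Hessian of the distance drops out.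
  have hD₂I : Integrable (fun x : N.Chans × N.Obs => D₂ (x.1 e, x.2 e)) (f.fibre P) := by
    have hsum : Integrable (fun x => ∑ a, ∑ b, N.q e P a * N.q e P b *
        S (N.rx e, a) (N.rx e, b) x) (f.fibre P) :=
      integrable_finsetSum _ fun a _ => integrable_finsetSum _ fun b _ =>
        (hSI _ _).const_mul _
    refine hsum.congr ?_
    filter_upwards [hform] with x hx
    have h1 := N.sum_q_partial₂_dist e (h.dist_pos e)
    have h2 := N.sum_q_sq e (h.dist_pos e)
    simp only [hx, N.sgn_rx, Fin.sum_univ_two] at h1 h2 ⊢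
    -- The contraction multiplies `D₂` by `(q₀² + q₁²)²`, and `s² - 1 = (s + 1)(s - 1)` with `s =
    -- q₀² + q₁²`.
    linear_combination D₁ (x.1 e, x.2 e) * h1 +
      D₂ (x.1 e, x.2 e) * (N.q e P 0 ^ 2 + N.q e P 1 ^ 2 + 1) * h2
  -- The score is kept together with its coefficient, which may vanish; only this product is known
  -- to be integrable.
  have hD₁I : Integrable (fun x : N.Chans × N.Obs =>
      partial₂ (N.dist e) (N.posDir i) (N.posDir j) P * D₁ (x.1 e, x.2 e)) (f.fibre P) := by
    refine ((hSI i j).sub (hD₂I.const_mul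
      (N.sgn e i.1 * N.sgn e j.1 * (N.q e P i.2 * N.q e P j.2)))).congr ?_
    filter_upwards [hform] with x hx
    simp [hx i j]
  have h1 := (f.link_fibre h.dist_pos e hD₂I).2
  have h2 := (f.link_fibre (G := fun w =>
    partial₂ (N.dist e) (N.posDir i) (N.posDir j) P * D₁ w) h.dist_pos e hD₁I).2
  have h3 : ∫ w, D₁ w ∂f.linkLaw e (N.dist e P) = 0 := h.score
  rw [integral_const_mul (μ := f.linkLaw e (N.dist e P)), h3, mul_zero] at h2
  rw [integral_neg, integral_congr_ae (hform.mono fun x hx => hx i j),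
    integral_add (hD₂I.const_mul _) hD₁I, h2, integral_const_mul, h1, Phi, integral_neg]
  ring

theorem integral_pos_chan (h : f.RegularAt e P) (i : N.PosIdx) (c : N.Coord e) :
    ∫ x : N.Chans × N.Obs, - partial₂
        (fun θ : N.Param => f.linkLog e (N.recv₁ e (N.dist e P) (x.1 e) (x.2 e))
          (N.dist e θ.1, θ.2 e)) (N.paramDir (Sum.inl i)) (N.paramDir (Sum.inr ⟨e, c⟩)) (P, x.1)
        ∂f.fibre P =
      N.sgn e i.1 * (N.q e P i.2 * f.Phi e (Sum.inl ()) (Sum.inr c) (N.dist e P)) := by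
  have hform : ∀ᵐ x ∂f.fibre P, partial₂
        (fun θ : N.Param => f.linkLog e (N.recv₁ e (N.dist e P) (x.1 e) (x.2 e))
          (N.dist e θ.1, θ.2 e)) (N.paramDir (Sum.inl i)) (N.paramDir (Sum.inr ⟨e, c⟩)) (P, x.1) =
      N.sgn e i.1 * N.q e P i.2 *
        partial₂ (f.linkLog e (N.recv₁ e (N.dist e P) (x.1 e) (x.2 e)))
          (N.linkDir e (Sum.inl ())) (N.linkDir e (Sum.inr c)) (N.dist e P, x.1 e) := by
    filter_upwards [h.contDiffAt] with x hx
    exact Network.partial₂_link_pos_chan (θ := (P, x.1)) (h.dist_pos e) hx i c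
  have h2 := (f.link_fibre (G := fun w => N.sgn e i.1 * N.q e P i.2 *
        partial₂ (f.linkLog e (N.recv₁ e (N.dist e P) w.1 w.2))
          (N.linkDir e (Sum.inl ())) (N.linkDir e (Sum.inr c)) (N.dist e P, w.1)) h.dist_pos e
    ((h.integrable _ _).congr hform)).2
  rw [integral_neg, integral_congr_ae hform, h2, integral_const_mul, Phi, integral_neg]
  ring

theorem integral_chan_chan (h : f.RegularAt e P) (c c' : N.Coord e) :
    ∫ x : N.Chans × N.Obs, - partial₂
        (fun θ : N.Param => f.linkLog e (N.recv₁ e (N.dist e P) (x.1 e) (x.2 e))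
          (N.dist e θ.1, θ.2 e)) (N.paramDir (Sum.inr ⟨e, c⟩)) (N.paramDir (Sum.inr ⟨e, c'⟩))
            (P, x.1) ∂f.fibre P =
      f.Phi e (Sum.inr c) (Sum.inr c') (N.dist e P) := by
  have hform : ∀ᵐ x ∂f.fibre P, partial₂
        (fun θ : N.Param => f.linkLog e (N.recv₁ e (N.dist e P) (x.1 e) (x.2 e))
          (N.dist e θ.1, θ.2 e)) (N.paramDir (Sum.inr ⟨e, c⟩)) (N.paramDir (Sum.inr ⟨e, c'⟩))
            (P, x.1) =
        partial₂ (f.linkLog e (N.recv₁ e (N.dist e P) (x.1 e) (x.2 e)))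
          (N.linkDir e (Sum.inr c)) (N.linkDir e (Sum.inr c')) (N.dist e P, x.1 e) := by
    filter_upwards [h.contDiffAt] with x hx
    exact Network.partial₂_link_chan_chan (θ := (P, x.1)) (h.dist_pos e) hx c c'
  have h2 := (f.link_fibre (G := fun w =>
        partial₂ (f.linkLog e (N.recv₁ e (N.dist e P) w.1 w.2))
          (N.linkDir e (Sum.inr c)) (N.linkDir e (Sum.inr c')) (N.dist e P, w.1)) h.dist_pos e
    ((h.integrable _ _).congr hform)).2
  rw [integral_neg, integral_congr_ae hform, h2, Phi, integral_neg]

theorem Phi_symm (h : f.RegularAt e P) (i j : Unit ⊕ N.Coord e) :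
    f.Phi e i j (N.dist e P) = f.Phi e j i (N.dist e P) := by
  refine integral_congr_ae ?_
  filter_upwards [f.ae_link (p := fun w => ContDiffAt ℝ 2
    (f.linkLog e (N.recv₁ e (N.dist e P) w.1 w.2)) (N.dist e P, w.1)) h.dist_pos e h.contDiffAt]
    with w hw
  rw [partial₂_symm hw]

end RegularAt

/-! ### The blocks of the Fisher information matrix -/

theorem Regular.linkFisher_eq (hreg : f.Regular) (e : N.Link) (i j : N.PosIdx ⊕ N.ChanIdx) :
    f.linkFisher e i j = ∫ P, ∫ x : N.Chans × N.Obs, - partial₂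
      (fun θ : N.Param => f.linkLog e (N.recv₁ e (N.dist e P) (x.1 e) (x.2 e))
        (N.dist e θ.1, θ.2 e)) (N.paramDir i) (N.paramDir j) (P, x.1) ∂f.fibre P ∂f.posLaw :=
  f.integral_law (hreg.link_integrable e i j).neg

theorem Regular.linkFisher_pos_pos (hreg : f.Regular) (e : N.Link) (i j : N.PosIdx) :
    f.linkFisher e (Sum.inl i) (Sum.inl j) = N.sgn e i.1 * N.sgn e j.1 * f.meanDD e i.2 j.2 := by
  rw [hreg.linkFisher_eq, integral_congr_ae ((hreg.regularAt e).mono fun P hP =>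
    hP.integral_pos_pos i j), integral_const_mul]
  rfl

theorem Regular.linkFisher_pos_chan (hreg : f.Regular) (e : N.Link) (i : N.PosIdx)
    (c : N.Coord e) :
    f.linkFisher e (Sum.inl i) (Sum.inr ⟨e, c⟩) = N.sgn e i.1 * f.meanDK e i.2 c := by
  rw [hreg.linkFisher_eq, integral_congr_ae ((hreg.regularAt e).mono fun P hP =>
    hP.integral_pos_chan i c), integral_const_mul]
  rfl

theorem Regular.linkFisher_chan_chan (hreg : f.Regular) (e : N.Link) (c c' : N.Coord e) :
    f.linkFisher e (Sum.inr ⟨e, c⟩) (Sum.inr ⟨e, c'⟩) = f.meanKK e c c' := by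
  rw [hreg.linkFisher_eq, integral_congr_ae ((hreg.regularAt e).mono fun P hP =>
    hP.integral_chan_chan c c')]
  rfl

theorem Regular.linkFisher_of_ne_right (hreg : f.Regular) (e : N.Link)
    (i : N.PosIdx ⊕ N.ChanIdx) (x : N.ChanIdx) (hx : x.1 ≠ e) :
    f.linkFisher e i (Sum.inr x) = 0 := by
  refine integral_eq_zero_of_ae ?_
  filter_upwards [hreg.contDiffAt_linkLog_ae, f.ae_law_of_posLaw f.dist_pos_ae] with ω h1 h2
  rw [Network.partial₂_link_of_ne_right (h2 e) (h1 e) i x hx, neg_zero, Pi.zero_apply]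

theorem Regular.linkFisher_of_ne_left (hreg : f.Regular) (e : N.Link) (x : N.ChanIdx)
    (j : N.PosIdx ⊕ N.ChanIdx) (hx : x.1 ≠ e) :
    f.linkFisher e (Sum.inr x) j = 0 := by
  refine integral_eq_zero_of_ae ?_
  filter_upwards [hreg.contDiffAt_linkLog_ae, f.ae_law_of_posLaw f.dist_pos_ae] with ω h1 h2
  rw [Network.partial₂_link_of_ne_left (h2 e) (h1 e) x j hx, neg_zero, Pi.zero_apply]

theorem Regular.meanKD_eq (hreg : f.Regular) (e : N.Link) : f.meanKD e = (f.meanDK e)ᵀ := by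
  ext c a
  refine integral_congr_ae ?_
  filter_upwards [hreg.regularAt e] with P hP
  rw [hP.Phi_symm, mul_comm]

theorem Regular.fisher_toBlocks₁₁ (hreg : f.Regular) (i j : N.PosIdx) :
    f.fisher.toBlocks₁₁ i j =
      f.Xi i j + ∑ e : N.Link, N.sgn e i.1 * N.sgn e j.1 * f.meanDD e i.2 j.2 := by
  rw [Matrix.toBlocks₁₁, Matrix.of_apply, hreg.fisher_eq, Matrix.fromBlocks_apply₁₁]
  simp_rw [hreg.linkFisher_pos_pos]

theorem Regular.fisher_toBlocks₁₂ (hreg : f.Regular) (i : N.PosIdx) (x : N.ChanIdx) :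
    f.fisher.toBlocks₁₂ i x = N.sgn x.1 i.1 * f.meanDK x.1 i.2 x.2 := by
  rw [Matrix.toBlocks₁₂, Matrix.of_apply, hreg.fisher_eq, Matrix.fromBlocks_apply₁₂,
    Matrix.zero_apply, zero_add, Finset.sum_eq_single x.1
      (fun e _ he => hreg.linkFisher_of_ne_right e _ x he.symm) (by simp)]
  exact hreg.linkFisher_pos_chan x.1 i x.2

/-- Each waveform involves only its own channel parameters, so no term couples two different
waveforms, and `ln f(P)` contributes nothing here. -/
theorem Regular.fisher_toBlocks₂₂ (hreg : f.Regular) :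
    f.fisher.toBlocks₂₂ = Matrix.blockDiagonal' f.meanKK := by
  ext x y
  rw [Matrix.toBlocks₂₂, Matrix.of_apply, hreg.fisher_eq, Matrix.fromBlocks_apply₂₂,
    Matrix.zero_apply, zero_add, Finset.sum_eq_single x.1
      (fun e _ he => hreg.linkFisher_of_ne_left e x _ he.symm) (by simp)]
  obtain ⟨e, c⟩ := x
  obtain ⟨e', c'⟩ := y
  by_cases he : e' = e
  · subst he
    rw [Matrix.blockDiagonal'_apply_eq]
    exact hreg.linkFisher_chan_chan e' c c'
  · rw [Matrix.blockDiagonal'_apply_ne _ _ _ (Ne.symm he)]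
    exact hreg.linkFisher_of_ne_right e _ ⟨e', c'⟩ he

end Prior

end CoopLoc

end

noncomputable section

namespace CoopLoc

/-! ### Invertibility and inverses of block diagonal matrices. -/

section BlockDiagonal

variable {o : Type*} [Fintype o] [DecidableEq o] {n : o → Type*} [∀ i, Fintype (n i)]

theorem mul_blockDiagonal'_apply {l : Type*} (A : Matrix l (Σ i, n i) ℝ)
    (M : ∀ i, Matrix (n i) (n i) ℝ) (x : l) (i : o) (c : n i) :
    (A * Matrix.blockDiagonal' M) x ⟨i, c⟩ = ∑ c', A x ⟨i, c'⟩ * M i c' c := by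
  rw [Matrix.mul_apply, Fintype.sum_sigma, Finset.sum_eq_single i]
  · simp [Matrix.blockDiagonal'_apply_eq]
  · intro j _ hj
    simp [Matrix.blockDiagonal'_apply_ne M _ _ hj]
  · simp

variable [∀ i, DecidableEq (n i)]

/-- The diagonal block of a left inverse is a left inverse of `M i`, and one-sided inverses suffice
for square matrices. -/
theorem isUnit_of_isUnit_blockDiagonal' {M : ∀ i, Matrix (n i) (n i) ℝ}
    (h : IsUnit (Matrix.blockDiagonal' M)) (i : o) : IsUnit (M i) := by
  obtain ⟨A, hA⟩ := h.exists_left_inv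
  have h1 : (Matrix.of fun c c' => A ⟨i, c⟩ ⟨i, c'⟩) * M i = 1 := by
    ext c c'
    have h2 := congrFun (congrFun hA ⟨i, c⟩) ⟨i, c'⟩
    rw [mul_blockDiagonal'_apply] at h2
    rw [Matrix.mul_apply]
    refine h2.trans ?_
    simp [Matrix.one_apply]
  exact IsUnit.of_mul_eq_one_right _ h1

theorem inv_blockDiagonal' {M : ∀ i, Matrix (n i) (n i) ℝ} (h : ∀ i, IsUnit (M i)) :
    (Matrix.blockDiagonal' M)⁻¹ = Matrix.blockDiagonal' fun i => (M i)⁻¹ := by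
  refine Matrix.inv_eq_right_inv ?_
  rw [← Matrix.blockDiagonal'_mul]
  simp_rw [fun i => Matrix.mul_nonsing_inv (M i) ((Matrix.isUnit_iff_isUnit_det _).1 (h i))]
  exact Matrix.blockDiagonal'_one

end BlockDiagonal

/-! ### Schur complement and assembly over the network graph. -/

variable {Na Nb : ℕ} {N : Network Na Nb}

/-- The quadratic form of a complete graph with weights on ordered pairs. -/
theorem sum_incidence_mul {ι : Type*} [Fintype ι] [DecidableEq ι] (g : ι → ι → ℝ)
    (hg : ∀ k, g k k = 0) (k m : ι) :
    ∑ x, ∑ y, ((if x = k then 1 else 0) - (if y = k then 1 else 0)) *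
        ((if x = m then 1 else 0) - (if y = m then (1 : ℝ) else 0)) * g x y =
      if k = m then ∑ y ∈ Finset.univ.erase k, (g k y + g y k) else -(g k m + g m k) := by
  have h : ∀ x y, ((if x = k then 1 else 0) - (if y = k then 1 else 0)) *
        ((if x = m then 1 else 0) - (if y = m then (1 : ℝ) else 0)) * g x y =
      (if x = k then (if x = m then g x y else 0) else 0)
        - (if x = k then (if y = m then g x y else 0) else 0)
        - (if x = m then (if y = k then g x y else 0) else 0)
        + (if y = k then (if y = m then g x y else 0) else 0) := by
    intro x y
    split_ifs <;> ring
  simp_rw [h, Finset.sum_add_distrib, Finset.sum_sub_distrib]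
  have h1 : ∀ (k : ι) (F : ι → ι → ℝ),
      ∑ x, ∑ y, (if x = k then F x y else 0) = ∑ y, F k y := by
    intro k F
    rw [Finset.sum_comm]
    simp
  rw [h1, h1, h1]
  by_cases hkm : k = m
  · subst hkm
    -- The erased term is zero by `hg`, so the sum may run over all vertices.
    have h2 := Finset.sum_erase (s := Finset.univ) (f := fun y => g k y + g y k) (a := k)
      (by simp [hg])
    rw [Finset.sum_add_distrib, Finset.sum_add_distrib] at h2
    rw [if_pos rfl, h2]
    simp [hg]
  · simp [hkm]
    ring

namespace Prior

variable {f : Prior N}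

theorem Regular.isUnit_meanKK (hreg : f.Regular) (hinv : IsUnit f.fisher.toBlocks₂₂)
    (e : N.Link) : IsUnit (f.meanKK e) := by
  rw [hreg.fisher_toBlocks₂₂] at hinv
  exact isUnit_of_isUnit_blockDiagonal' hinv e

theorem Regular.schur_correction (hreg : f.Regular) (hinv : IsUnit f.fisher.toBlocks₂₂)
    (i j : N.PosIdx) :
    (f.fisher.toBlocks₁₂ * (f.fisher.toBlocks₂₂)⁻¹ * (f.fisher.toBlocks₁₂)ᵀ) i j =
      ∑ e : N.Link, N.sgn e i.1 * N.sgn e j.1 *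
        (f.meanDK e * (f.meanKK e)⁻¹ * f.meanKD e) i.2 j.2 := by
  rw [hreg.fisher_toBlocks₂₂, inv_blockDiagonal' (hreg.isUnit_meanKK hinv), Matrix.mul_apply,
    Fintype.sum_sigma]
  refine Finset.sum_congr rfl fun e _ => ?_
  rw [Matrix.mul_apply, Finset.mul_sum]
  refine Finset.sum_congr rfl fun c _ => ?_
  rw [mul_blockDiagonal'_apply, Matrix.transpose_apply, hreg.meanKD_eq, Matrix.transpose_apply,
    hreg.fisher_toBlocks₁₂, Matrix.mul_apply]
  simp_rw [hreg.fisher_toBlocks₁₂]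
  simp only [Finset.sum_mul, Finset.mul_sum]
  exact Finset.sum_congr rfl fun c' _ => by ring

theorem Regular.equivFisher_apply (hreg : f.Regular) (hinv : IsUnit f.fisher.toBlocks₂₂)
    (i j : N.PosIdx) :
    equivFisher f.fisher i j =
      f.Xi i j + ∑ e : N.Link, N.sgn e i.1 * N.sgn e j.1 * f.linkRI e i.2 j.2 := by
  rw [equivFisher, Matrix.sub_apply, hreg.schur_correction hinv, hreg.fisher_toBlocks₁₁,
    add_sub_assoc, ← Finset.sum_sub_distrib]
  simp only [linkRI, Matrix.sub_apply, mul_sub]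

theorem RI_self (f : Prior N) (k : Fin Na) : f.RI k (Sum.inl k) = 0 := by
  simp [RI]

/-- `RI` vanishes off the received waveforms, so the sum over links extends to all pairs of an agent
and a node, where it can be split into agents and anchors. -/
theorem sum_link (f : Prior N) (g : Fin Na → Node Na Nb → ℝ) (a b : Fin 2) :
    ∑ e : N.Link, g (N.rx e) (N.tx e) * f.linkRI e a b = ∑ k, ∑ j, g k j * f.RI k j a b := by
  have h1 : ∀ e : N.Link, g (N.rx e) (N.tx e) * f.linkRI e a b =
      g e.1.1 e.1.2 * f.RI e.1.1 e.1.2 a b := by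
    intro e
    rw [RI, dif_pos e.2]
  rw [Fintype.sum_congr _ _ h1, ← Fintype.sum_prod_type' fun k j => g k j * f.RI k j a b]
  rw [← Finset.sum_subtype (Finset.univ.filter fun x : Fin Na × Node Na Nb =>
    x.2 ≠ Sum.inl x.1 ∧ N.comm x.1 x.2 = true) (by simp)
    fun x => g x.1 x.2 * f.RI x.1 x.2 a b]
  refine Finset.sum_filter_of_ne fun x _ hx => ?_
  by_contra h
  exact hx (by rw [RI, dif_neg h, Matrix.zero_apply, mul_zero])

theorem sum_sgn_linkRI (f : Prior N) (i j : N.PosIdx) :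
    ∑ e : N.Link, N.sgn e i.1 * N.sgn e j.1 * f.linkRI e i.2 j.2 = (f.JA + f.JC) i j := by
  have h := f.sum_link (fun k t =>
    ((if k = i.1 then 1 else 0) - (if t = Sum.inl i.1 then 1 else 0)) *
      ((if k = j.1 then 1 else 0) - (if t = Sum.inl j.1 then 1 else 0))) i.2 j.2
  refine h.trans ?_
  simp only [Fintype.sum_sum_type, Finset.sum_add_distrib, Sum.inl.injEq, reduceCtorEq, if_false,
    sub_zero]
  rw [sum_incidence_mul (fun k m => f.RI k (Sum.inl m) i.2 j.2) (by simp [RI_self])]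
  rw [Matrix.add_apply, JA, JC, Matrix.of_apply, Matrix.of_apply, add_comm]
  congr 1
  -- An anchor is never one of the agents, so only the receiver's indicators remain and just `k =
  -- i.1` contributes.
  · rw [Finset.sum_eq_single i.1 (fun k _ hk => by simp [hk]) (by simp)]
    by_cases hij : i.1 = j.1 <;> simp [hij, Matrix.sum_apply]
  · by_cases hij : i.1 = j.1
    · simp [hij, Matrix.sum_apply]
    · simp [hij]

end Prior

end CoopLoc

end

theorem theorem3 {Na Nb : ℕ} (N : CoopLoc.Network Na Nb) (f : CoopLoc.Prior N)
    (hreg : f.Regular) (hinv : IsUnit f.fisher.toBlocks₂₂) :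
    (∀ e : N.Link, IsUnit (f.meanKK e)) ∧
      CoopLoc.equivFisher f.fisher = f.JA + f.JC + f.Xi := by
  refine ⟨hreg.isUnit_meanKK hinv, ?_⟩
  ext i j
  rw [hreg.equivFisher_apply hinv, f.sum_sgn_linkRI, Matrix.add_apply (f.JA + f.JC), add_comm]
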